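/- Let $K\subset\mathbb{R}^3$ be a convex body (a compact convex set with nonempty interior) that is centrally symmetric, $K=-K$. Assume that the boundary $\partial K$ is a $C^\infty$ hypersurface and that $K$ is strongly convex, i.e. for $h_K=\tfrac12\mu_K^2$, where $\mu_K(x)=\min\{\lambda\ge 0 : x\in\lambda K\}$ is the Minkowski gauge of $K$, the Hessian matrix $D^2h_K(x)$ is positive definite for every $x$ with $|x|=1$. If $K$ is symmetric with respect to a plane (i.e. $K$ is invariant under the orthogonal reflection in some plane of $\mathbb{R}^3$), then its volume product satisfies $$\mathcal{P}(K):=\min_{z\in\operatorname{int}K}|K|\,|K^z|\ \ge\ \frac{32}{3},$$ where $|\cdot|$ denotes three-dimensional volume and $K^z=\{y\in\mathbb{R}^3 : (y-z)\cdot(x-z)\le 1\text{ for all }x\in K\}$ is the polar body of $K$ with respect to $z$. -/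

import Mathlib

open scoped ENNReal Pointwise ContDiff

/-- A convex body in `ℝⁿ`: a compact convex set with nonempty interior. -/
structure IsConvexBody {n : ℕ} (K : Set (EuclideanSpace ℝ (Fin n))) : Prop where
  convex : Convex ℝ K
  isCompact : IsCompact K
  interior_nonempty : (interior K).Nonempty

/-- `K = -K`. -/
def IsCentrallySymmetric {n : ℕ} (K : Set (EuclideanSpace ℝ (Fin n))) : Prop :=
  K = -K

/-- The polar body of `K` with respect to `z`: all `y` with
`(y - z) · (x - z) ≤ 1` for every `x ∈ K`. -/
def polarBody {n : ℕ} (K : Set (EuclideanSpace ℝ (Fin n))) (z : EuclideanSpace ℝ (Fin n)) :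
    Set (EuclideanSpace ℝ (Fin n)) :=
  {y | ∀ x ∈ K, inner ℝ (y - z) (x - z) ≤ 1}

/-- The volume product: the minimum over `z ∈ int K` of `|K| |K^z|`, as an infimum in `[0, ∞]`. -/
noncomputable def volumeProduct {n : ℕ} (K : Set (EuclideanSpace ℝ (Fin n))) : ℝ≥0∞ :=
  ⨅ z ∈ interior K, MeasureTheory.volume K * MeasureTheory.volume (polarBody K z)

/-- `M` is a `C^∞` hypersurface in `ℝⁿ`: near each of its points it is the zero set of a
`C^∞` function whose differential does not vanish at that point. -/
def IsSmoothHypersurface {n : ℕ} (M : Set (EuclideanSpace ℝ (Fin n))) : Prop :=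
  ∀ p ∈ M, ∃ (U : Set (EuclideanSpace ℝ (Fin n))) (f : EuclideanSpace ℝ (Fin n) → ℝ),
    IsOpen U ∧ p ∈ U ∧ ContDiffOn ℝ ∞ f U ∧ fderiv ℝ f p ≠ 0 ∧ M ∩ U = {x ∈ U | f x = 0}

/-- `h_K = μ_K² / 2`, where `μ_K` is the Minkowski gauge of `K`. -/
noncomputable def halfSqGauge {n : ℕ} (K : Set (EuclideanSpace ℝ (Fin n)))
    (x : EuclideanSpace ℝ (Fin n)) : ℝ :=
  gauge K x ^ 2 / 2

/-- Strong convexity of a body with smooth boundary and the origin in its interior: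
the Hessian of `h_K` is positive definite at every point of the unit sphere. -/
def IsStronglyConvexBody {n : ℕ} (K : Set (EuclideanSpace ℝ (Fin n))) : Prop :=
  ∀ x : EuclideanSpace ℝ (Fin n), ‖x‖ = 1 → ∀ v : EuclideanSpace ℝ (Fin n), v ≠ 0 →
    0 < fderiv ℝ (fderiv ℝ (halfSqGauge K)) x v v

open MeasureTheory Set

/-! The bound comes from an induction on dimension for bodies that the coordinate hyperplanes cut
into equal pieces. Let `K` be such a body in dimension `N`, let `V` be its volume, `K°` its polar at
the origin and `a_i` the volume of its `i`-th coordinate section, and suppose the sections are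
equipartitioned too. For `x ∈ K`, the pyramids with apex `x` over the parts of the sections in the
orthant of `x` are disjoint and lie in `K`, so `∑ 2 |x_i| a_i ≤ N V` (`sum_mul_volume_slice_le`).
Thus `K°` contains the box with half-widths `2 a_i / (N V)`, and comparing `K°` with this box
through a mixed volume (`sum_mul_volume_proj_le`) gives `4 ∑ a_i |π_i K°| ≤ N² V |K°|`, where `π_i`
is the projection along the `i`-th axis. Since `π_i K°` contains the polar of the `i`-th section,
each `a_i |π_i K°|` is at least the bound `m` known in dimension `N - 1`, and `|K| |K°| ≥ 4 m / N`
follows. The successive bounds are 1, 4, 8, 32/3.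

The volume product is linearly invariant, so it suffices to reach an equipartitioned position by a
linear map. In the plane a continuity argument finds two lines that cut two even densities into
quarters at once (`exists_matrix_equipartition`). In space, apply this inside the mirror plane to
the central section and to the fibre-length density of `K`. The mirror halves each of the four
resulting wedges, and the other two coordinate sections are equipartitioned by symmetry.

Two reductions complete the proof. The minimum over `z` is attained at the origin by central
symmetry (`SymmBody.volume_polar_le`), and boundedness forces the mirror through the origin
(`linear_reflection_mem`). -/

namespace VolumeProduct

/-! ### Coordinate splitting, Fubini, sections and projections. -/

/-- The vector with `i`-th coordinate `s` and remaining coordinates `p`. -/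
def ins {n : ℕ} (i : Fin (n + 1)) (s : ℝ) (p : Fin n → ℝ) : Fin (n + 1) → ℝ :=
  Fin.insertNth (α := fun _ => ℝ) i s p

@[simp]
lemma ins_self {n : ℕ} (i : Fin (n + 1)) (s : ℝ) (p : Fin n → ℝ) : ins i s p i = s :=
  Fin.insertNth_apply_same (α := fun _ => ℝ) i s p

@[simp]
lemma ins_succAbove {n : ℕ} (i : Fin (n + 1)) (s : ℝ) (p : Fin n → ℝ) (j : Fin n) :
    ins i s p (i.succAbove j) = p j :=
  Fin.insertNth_apply_succAbove (α := fun _ => ℝ) i s p j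

lemma ext_ins {n : ℕ} (i : Fin (n + 1)) {x y : Fin (n + 1) → ℝ} (h : x i = y i)
    (h' : ∀ j, x (i.succAbove j) = y (i.succAbove j)) : x = y := by
  funext k
  rcases Fin.eq_self_or_eq_succAbove i k with rfl | ⟨j, rfl⟩
  · exact h
  · exact h' j

lemma ins_eta {n : ℕ} (i : Fin (n + 1)) (x : Fin (n + 1) → ℝ) :
    ins i (x i) (fun j => x (i.succAbove j)) = x :=
  ext_ins i (by simp) (by simp)

lemma ins_add {n : ℕ} (i : Fin (n + 1)) (s t : ℝ) (p q : Fin n → ℝ) :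
    ins i (s + t) (p + q) = ins i s p + ins i t q :=
  ext_ins i (by simp) (by simp)

lemma ins_smul {n : ℕ} (i : Fin (n + 1)) (c s : ℝ) (p : Fin n → ℝ) :
    ins i (c * s) (c • p) = c • ins i s p :=
  ext_ins i (by simp) (by simp)

@[fun_prop]
lemma continuous_ins {n : ℕ} (i : Fin (n + 1)) :
    Continuous fun q : ℝ × (Fin n → ℝ) => ins i q.1 q.2 := by
  refine continuous_pi fun k => ?_
  rcases Fin.eq_self_or_eq_succAbove i k with rfl | ⟨j, rfl⟩
  · simpa using continuous_fst
  · simpa using (by fun_prop : Continuous fun a : ℝ × (Fin n → ℝ) => a.2 j)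

lemma measurePreserving_ins {n : ℕ} (i : Fin (n + 1)) :
    MeasurePreserving (fun q : ℝ × (Fin n → ℝ) => ins i q.1 q.2) volume volume :=
  (volume_preserving_piFinSuccAbove (fun _ => ℝ) i).symm

/-- Fubini: integrate the lengths of the fibres in direction `i`. -/
lemma volume_eq_lintegral_fiber {n : ℕ} (i : Fin (n + 1)) {S : Set (Fin (n + 1) → ℝ)}
    (hS : MeasurableSet S) :
    volume S = ∫⁻ p : Fin n → ℝ, volume {s : ℝ | ins i s p ∈ S} := by
  rw [← (measurePreserving_ins i).measure_preimage hS.nullMeasurableSet, Measure.volume_eq_prod,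
    Measure.prod_apply_symm ((continuous_ins i).measurable hS)]
  rfl

/-- Cavalieri: integrate the volumes of the sections orthogonal to direction `i`. -/
lemma volume_eq_lintegral_section {n : ℕ} (i : Fin (n + 1)) {S : Set (Fin (n + 1) → ℝ)}
    (hS : MeasurableSet S) :
    volume S = ∫⁻ s : ℝ, volume {p : Fin n → ℝ | ins i s p ∈ S} := by
  rw [← (measurePreserving_ins i).measure_preimage hS.nullMeasurableSet, Measure.volume_eq_prod,
    Measure.prod_apply ((continuous_ins i).measurable hS)]
  rfl

/-- The section of `K` by the `i`-th coordinate hyperplane. -/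
def slice {n : ℕ} (i : Fin (n + 1)) (K : Set (Fin (n + 1) → ℝ)) : Set (Fin n → ℝ) :=
  {p | ins i 0 p ∈ K}

/-- The projection of `K` along the `i`-th coordinate axis. -/
def proj {n : ℕ} (i : Fin (n + 1)) (K : Set (Fin (n + 1) → ℝ)) : Set (Fin n → ℝ) :=
  {p | ∃ s, ins i s p ∈ K}

lemma proj_mono {n : ℕ} (i : Fin (n + 1)) {K L : Set (Fin (n + 1) → ℝ)} (h : K ⊆ L) :
    proj i K ⊆ proj i L := fun _ ⟨s, hs⟩ => ⟨s, h hs⟩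

lemma proj_eq_image {n : ℕ} (i : Fin (n + 1)) (K : Set (Fin (n + 1) → ℝ)) :
    proj i K = (fun x j => x (i.succAbove j)) '' K := by
  ext p
  constructor
  · rintro ⟨s, hs⟩
    exact ⟨_, hs, by simp⟩
  · rintro ⟨x, hx, rfl⟩
    exact ⟨x i, by rwa [ins_eta]⟩

lemma isCompact_proj {n : ℕ} (i : Fin (n + 1)) {K : Set (Fin (n + 1) → ℝ)} (hK : IsCompact K) :
    IsCompact (proj i K) := by
  rw [proj_eq_image]
  exact hK.image (by fun_prop)

lemma isCompact_fiber {n : ℕ} (i : Fin (n + 1)) {K : Set (Fin (n + 1) → ℝ)} (hK : IsCompact K)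
    (p : Fin n → ℝ) : IsCompact {s : ℝ | ins i s p ∈ K} := by
  refine (hK.image (continuous_apply i)).of_isClosed_subset
    (hK.isClosed.preimage ((continuous_ins i).comp (by fun_prop : Continuous fun s => (s, p)))) ?_
  intro s hs
  exact ⟨_, hs, by simp⟩

/-! ### Mixed volume of a convex body with a box. -/

/-- Intervals of length `c` can be attached beyond the maximum and before the minimum of `F`,
disjointly from `F` and inside `G`. -/
lemma volume_add_le_of_thickening_subset {F G : Set ℝ} (hF : IsCompact F) (hne : F.Nonempty)
    {c : ℝ} (hc : 0 ≤ c) (h : ∀ s ∈ F, ∀ r, |r| ≤ c → s + r ∈ G) :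
    volume F + ENNReal.ofReal (2 * c) ≤ volume G := by
  obtain ⟨a, haF, ha⟩ := hF.exists_isLeast hne
  obtain ⟨b, hbF, hb⟩ := hF.exists_isGreatest hne
  have h1 : Disjoint F (Ioc b (b + c)) := by
    rw [Set.disjoint_left]
    intro s hs hs'
    exact absurd (hb hs) (not_le.2 hs'.1)
  have h2 : Disjoint (F ∪ Ioc b (b + c)) (Ico (a - c) a) := by
    rw [Set.disjoint_left]
    rintro s (hs | hs) hs'
    · exact absurd (ha hs) (not_le.2 hs'.2)
    · have := ha hbF
      linarith [hs.1, hs'.2]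
  have h3 : F ∪ Ioc b (b + c) ∪ Ico (a - c) a ⊆ G := by
    rintro s ((hs | hs) | hs)
    · simpa using h s hs 0 (by simpa)
    · have := h b hbF (s - b) (by rw [abs_le]; constructor <;> linarith [hs.1, hs.2])
      simpa using this
    · have := h a haF (s - a) (by rw [abs_le]; constructor <;> linarith [hs.1, hs.2])
      simpa using this
  calc volume F + ENNReal.ofReal (2 * c)
      = volume F + volume (Ioc b (b + c)) + volume (Ico (a - c) a) := by
        rw [Real.volume_Ioc, Real.volume_Ico, add_assoc, ← ENNReal.ofReal_add (by linarith)
          (by linarith)]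
        congr 2
        ring
    _ = volume (F ∪ Ioc b (b + c) ∪ Ico (a - c) a) := by
        rw [measure_union h2 measurableSet_Ico, measure_union h1 measurableSet_Ioc]
    _ ≤ volume G := measure_mono h3

/-- Thickening a compact set by a segment parallel to a coordinate axis. -/
lemma volume_add_proj_le {n : ℕ} (i : Fin (n + 1)) {M N : Set (Fin (n + 1) → ℝ)}
    (hM : IsCompact M) (hN : IsCompact N) {c : ℝ} (hc : 0 ≤ c)
    (h : ∀ x ∈ M, ∀ r, |r| ≤ c → x + ins i r 0 ∈ N) :
    volume M + ENNReal.ofReal (2 * c) * volume (proj i M) ≤ volume N := by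
  have hp := (isCompact_proj i hM).isClosed.measurableSet
  rw [volume_eq_lintegral_fiber i hM.isClosed.measurableSet,
    volume_eq_lintegral_fiber i hN.isClosed.measurableSet,
    ← lintegral_indicator_const hp, ← lintegral_add_right _ (measurable_const.indicator hp)]
  refine lintegral_mono fun p => ?_
  by_cases hpM : p ∈ proj i M
  · simp only [indicator_of_mem hpM]
    refine volume_add_le_of_thickening_subset (isCompact_fiber i hM p) hpM hc ?_
    intro s hs r hr
    have := h _ hs r hr
    rwa [← ins_add, add_zero] at this
  · simp only [indicator_of_notMem hpM, add_zero]
    refine measure_mono fun s hs => ?_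
    exact absurd ⟨s, hs⟩ hpM

/-- The box with half-widths `c`. -/
def box {n : ℕ} (c : Fin n → ℝ) : Set (Fin n → ℝ) := {y | ∀ i, |y i| ≤ c i}

lemma isCompact_box {n : ℕ} (c : Fin n → ℝ) : IsCompact (box c) := by
  have : box c = Set.pi univ fun i => Icc (-c i) (c i) := by
    ext y
    simp only [box, abs_le, mem_ofPred_eq, mem_univ_pi, mem_Icc]
  rw [this]
  exact isCompact_univ_pi fun _ => isCompact_Icc

/-- A box is a sum of axis-parallel segments, so the thickening is done one direction at a time. The
intermediate sets contain `L`, hence have larger projections, and the terms of higher order in `c`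
are dropped. -/
lemma volume_add_sum_proj_le {n : ℕ} {L : Set (Fin (n + 1) → ℝ)} (hL : IsCompact L)
    {c : Fin (n + 1) → ℝ} (hc : ∀ i, 0 ≤ c i) (S : Finset (Fin (n + 1))) :
    volume L + ∑ i ∈ S, ENNReal.ofReal (2 * c i) * volume (proj i L) ≤
      volume (L + box fun i => if i ∈ S then c i else 0) := by
  induction S using Finset.induction_on with
  | empty =>
    simp only [Finset.sum_empty, add_zero]
    refine measure_mono fun x hx => ⟨x, hx, 0, ?_, by simp⟩
    intro i
    simp
  | insert i S hi ih =>
    rw [Finset.sum_insert hi, add_left_comm, add_comm]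
    have hsub : L ⊆ L + box fun i => if i ∈ S then c i else 0 := by
      refine fun x hx => ⟨x, hx, 0, ?_, by simp⟩
      intro j
      simp only [Pi.zero_apply, abs_zero]
      split_ifs
      exacts [hc j, le_rfl]
    refine le_trans (add_le_add ih (mul_le_mul_right (measure_mono (proj_mono i hsub)) _)) ?_
    refine volume_add_proj_le i (hL.add (isCompact_box _)) (hL.add (isCompact_box _)) (hc i) ?_
    rintro _ ⟨x, hx, y, hy, rfl⟩ r hr
    refine ⟨x, hx, y + ins i r 0, ?_, by simp [add_assoc]⟩
    intro j
    have hj := hy j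
    rcases Fin.eq_self_or_eq_succAbove i j with rfl | ⟨k, rfl⟩
    · simp only [hi, if_false] at hj
      have : y j = 0 := abs_eq_zero.1 (le_antisymm hj (abs_nonneg _))
      simpa [this] using hr
    · simpa [Finset.mem_insert, Fin.succAbove_ne] using hj

/-- Both sides equal `V` at `t = 0`, so their right derivatives there are ordered. -/
lemma le_mul_of_forall_add_mul_le_pow {m : ℕ} {V B : ℝ}
    (h : ∀ t : ℝ, 0 < t → V + t * B ≤ (1 + t) ^ m * V) : B ≤ m * V := by
  have hd : HasDerivAt (fun t : ℝ => (1 + t) ^ m * V) (m * V) 0 := by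
    have := (((hasDerivAt_id (0 : ℝ)).const_add 1).pow m).mul_const V
    simpa using this
  have ht := (hasDerivAt_iff_tendsto_slope_zero.1 hd).mono_left
    (nhdsWithin_mono 0 (s := Ioi (0 : ℝ)) (t := {0}ᶜ) (fun t ht => (mem_Ioi.1 ht).ne'))
  refine ge_of_tendsto ht ?_
  filter_upwards [self_mem_nhdsWithin] with t ht
  have ht : 0 < t := ht
  have := h t ht
  simp only [zero_add, add_zero, one_pow, one_mul, smul_eq_mul]
  rw [inv_mul_eq_div, le_div_iff₀ ht]
  linarith

/-- If a convex body contains a box, its volume dominates the mixed volume with that box. -/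
theorem sum_mul_volume_proj_le {n : ℕ} {L : Set (Fin (n + 1) → ℝ)} (hL : IsCompact L)
    (hconv : Convex ℝ L) {c : Fin (n + 1) → ℝ} (hc : ∀ i, 0 ≤ c i) (hbox : box c ⊆ L) :
    ∑ i, 2 * c i * (volume (proj i L)).toReal ≤ (n + 1) * (volume L).toReal := by
  have hfin : volume L ≠ ⊤ := hL.measure_lt_top.ne
  have hpfin : ∀ i, volume (proj i L) ≠ ⊤ := fun i => (isCompact_proj i hL).measure_lt_top.ne
  have := le_mul_of_forall_add_mul_le_pow (m := n + 1) (V := (volume L).toReal)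
    (B := ∑ i, 2 * c i * (volume (proj i L)).toReal) ?_
  · exact_mod_cast this
  intro t ht
  have h1 := volume_add_sum_proj_le hL (c := fun i => t * c i)
    (fun i => mul_nonneg ht.le (hc i)) Finset.univ
  -- The scaled box lies in `t • L`, and convexity gives `L + t • L = (1 + t) • L`.
  have h2 : (L + box fun i => if i ∈ Finset.univ then t * c i else 0) ⊆ (1 + t) • L := by
    rw [hconv.add_smul zero_le_one ht.le, one_smul]
    refine add_subset_add_left fun y hy => ?_
    refine ⟨t⁻¹ • y, hbox fun i => ?_, by simp [smul_smul, ht.ne']⟩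
    have := hy i
    simp only [Finset.mem_univ, if_true] at this
    simp only [Pi.smul_apply, smul_eq_mul, abs_mul, abs_of_pos (inv_pos.2 ht)]
    rwa [inv_mul_le_iff₀ ht]
  have h3 := h1.trans (measure_mono h2)
  rw [Measure.addHaar_smul, Module.finrank_fin_fun, abs_of_pos (by positivity)] at h3
  have hs : ∑ i, ENNReal.ofReal (2 * (t * c i)) * volume (proj i L) ≠ ⊤ :=
    (ENNReal.sum_lt_top.2 fun i _ =>
      ENNReal.mul_lt_top ENNReal.ofReal_lt_top (hpfin i).lt_top).ne
  have h4 := ENNReal.toReal_mono (ENNReal.mul_ne_top ENNReal.ofReal_ne_top hfin) h3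
  rw [ENNReal.toReal_add hfin hs, ENNReal.toReal_mul, ENNReal.toReal_ofReal (by positivity),
    ENNReal.toReal_sum (fun i _ => ENNReal.mul_ne_top ENNReal.ofReal_ne_top (hpfin i))] at h4
  refine le_trans (le_of_eq ?_) h4
  rw [Finset.mul_sum]
  congr 1
  refine Finset.sum_congr rfl fun i _ => ?_
  rw [ENNReal.toReal_mul, ENNReal.toReal_ofReal (by have := hc i; positivity)]
  ring

/-! ### Orthants and pyramids over coordinate sections. -/

/-- The open orthant with sign vector `ε`. -/
def orthant {n : ℕ} (ε : Fin n → ℝ) : Set (Fin n → ℝ) := {y | ∀ i, 0 < ε i * y i}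

lemma isOpen_orthant {n : ℕ} (ε : Fin n → ℝ) : IsOpen (orthant ε) := by
  have : orthant ε = ⋂ i, {y | 0 < ε i * y i} := by
    ext y
    simp [orthant]
  rw [this]
  exact isOpen_iInter_of_finite fun i => isOpen_lt continuous_const (by fun_prop)

lemma measurableSet_orthant {n : ℕ} (ε : Fin n → ℝ) : MeasurableSet (orthant ε) :=
  (isOpen_orthant ε).measurableSet

lemma measurableSet_slice {n : ℕ} (i : Fin (n + 1)) {K : Set (Fin (n + 1) → ℝ)}
    (hK : MeasurableSet K) : MeasurableSet (slice i K) :=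
  ((continuous_ins i).comp (by fun_prop : Continuous fun p => ((0 : ℝ), p))).measurable hK

/-- The open pyramid with base `Q` in the `i`-th coordinate hyperplane and apex `x`. -/
def pyramid {n : ℕ} (i : Fin (n + 1)) (x : Fin (n + 1) → ℝ) (Q : Set (Fin n → ℝ)) :
    Set (Fin (n + 1) → ℝ) :=
  {y | y i / x i ∈ Ioo (0 : ℝ) 1 ∧
    (1 - y i / x i)⁻¹ • ((fun j => y (i.succAbove j)) - (y i / x i) • fun j => x (i.succAbove j)) ∈ Q}

lemma measurableSet_pyramid {n : ℕ} (i : Fin (n + 1)) (x : Fin (n + 1) → ℝ)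
    {Q : Set (Fin n → ℝ)} (hQ : MeasurableSet Q) : MeasurableSet (pyramid i x Q) := by
  have h1 : Measurable fun y : Fin (n + 1) → ℝ => y i / x i := by fun_prop
  have h2 : Measurable fun y : Fin (n + 1) → ℝ => (1 - y i / x i)⁻¹ •
      ((fun j => y (i.succAbove j)) - (y i / x i) • fun j => x (i.succAbove j)) := by
    refine measurable_pi_lambda _ fun j => ?_
    simp only [Pi.smul_apply, Pi.sub_apply, smul_eq_mul]
    fun_prop
  exact (h1 measurableSet_Ioo).inter (h2 hQ)

lemma lintegral_one_sub_pow (n : ℕ) :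
    ∫⁻ t in Ioo (0 : ℝ) 1, ENNReal.ofReal ((1 - t) ^ n) = ENNReal.ofReal (1 / (n + 1)) := by
  rw [← ofReal_integral_eq_lintegral_ofReal]
  · rw [← integral_Ioc_eq_integral_Ioo, ← intervalIntegral.integral_of_le zero_le_one,
      intervalIntegral.integral_comp_sub_left (fun t => t ^ n)]
    simp
  · exact (Continuous.integrableOn_Icc (by fun_prop)).mono_set Ioo_subset_Icc_self
  · filter_upwards [self_mem_ae_restrict measurableSet_Ioo] with t ht
    exact pow_nonneg (by linarith [ht.2]) _

lemma volume_preimage_inv_smul_sub {n : ℕ} {r : ℝ} (hr : 0 < r) (v : Fin n → ℝ)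
    (Q : Set (Fin n → ℝ)) :
    volume {p | r⁻¹ • (p - v) ∈ Q} = ENNReal.ofReal (r ^ n) * volume Q := by
  have h : {p | r⁻¹ • (p - v) ∈ Q} = (fun p => p + -v) ⁻¹' ((fun p => r⁻¹ • p) ⁻¹' Q) := by
    ext p
    simp [sub_eq_add_neg]
  rw [h, measure_preimage_add_right, Measure.addHaar_preimage_smul _ (inv_pos.2 hr).ne',
    Module.finrank_fin_fun, inv_pow, inv_inv, abs_of_pos (pow_pos hr n)]

lemma volume_pyramid {n : ℕ} (i : Fin (n + 1)) {x : Fin (n + 1) → ℝ} (hx : x i ≠ 0)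
    {Q : Set (Fin n → ℝ)} (hQ : MeasurableSet Q) :
    (n + 1) * volume (pyramid i x Q) = ENNReal.ofReal |x i| * volume Q := by
  -- At height `s`, with `t = s / x i`, the section is the base scaled by `1 - t` and translated.
  -- Integrating `(1 - t) ^ n` gives the factor `1 / (n + 1)`.
  have hsec : ∀ s : ℝ, volume {p : Fin n → ℝ | ins i s p ∈ pyramid i x Q} =
      (fun t => (Ioo (0 : ℝ) 1).indicator (fun t => ENNReal.ofReal ((1 - t) ^ n) * volume Q) t)
        (s * (x i)⁻¹) := by
    intro s
    by_cases hs : s * (x i)⁻¹ ∈ Ioo (0 : ℝ) 1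
    · simp only [indicator_of_mem hs]
      rw [← volume_preimage_inv_smul_sub (sub_pos.2 hs.2)
        ((s * (x i)⁻¹) • fun j => x (i.succAbove j))]
      congr 1
      ext p
      simp only [pyramid, mem_ofPred_eq, ins_self, ins_succAbove, div_eq_mul_inv]
      exact and_iff_right hs
    · simp only [indicator_of_notMem hs]
      have : {p : Fin n → ℝ | ins i s p ∈ pyramid i x Q} = ∅ := by
        ext p
        simp only [pyramid, mem_ofPred_eq, ins_self, div_eq_mul_inv, mem_empty_iff_false, iff_false]
        exact fun h => hs h.1
      rw [this, measure_empty]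
  have hmeas : Measurable fun t : ℝ =>
      (Ioo (0 : ℝ) 1).indicator (fun t => ENNReal.ofReal ((1 - t) ^ n) * volume Q) t :=
    Measurable.indicator (by fun_prop) measurableSet_Ioo
  rw [volume_eq_lintegral_section i (measurableSet_pyramid i x hQ), lintegral_congr hsec,
    ← lintegral_map hmeas (measurable_mul_const _), Real.map_volume_mul_right (inv_ne_zero hx),
    lintegral_smul_measure, lintegral_indicator measurableSet_Ioo,
    lintegral_mul_const _ (by fun_prop), lintegral_one_sub_pow, inv_inv, smul_eq_mul]
  have : (n + 1 : ℝ≥0∞) * ENNReal.ofReal (1 / (n + 1)) = 1 := by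
    rw [show (n + 1 : ℝ≥0∞) = ENNReal.ofReal (n + 1) by
      rw [ENNReal.ofReal_add (by positivity) zero_le_one]; simp,
      ← ENNReal.ofReal_mul (by positivity), mul_one_div_cancel (by positivity), ENNReal.ofReal_one]
  calc _ = ((n + 1 : ℝ≥0∞) * ENNReal.ofReal (1 / (n + 1))) *
        (ENNReal.ofReal |x i| * volume Q) := by ring
    _ = _ := by rw [this, one_mul]

/-- A convex set in an orthant contains the pyramids over its coordinate sections. -/
theorem sum_mul_volume_slice_le {n : ℕ} {K : Set (Fin (n + 1) → ℝ)} (hK : MeasurableSet K)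
    (hconv : Convex ℝ K) {ε x : Fin (n + 1) → ℝ} (hx : x ∈ K) (hε : ∀ i, 0 ≤ ε i * x i)
    (hε0 : ∀ i, ε i ≠ 0) :
    ∑ i, ENNReal.ofReal |x i| *
        volume (slice i K ∩ orthant fun j => ε (i.succAbove j)) ≤
      (n + 1) * volume (K ∩ orthant ε) := by
  classical
  set Q : Fin (n + 1) → Set (Fin n → ℝ) :=
    fun i => slice i K ∩ orthant fun j => ε (i.succAbove j) with hQdef
  have hQ : ∀ i, MeasurableSet (Q i) := fun i =>
    (measurableSet_slice i hK).inter (measurableSet_orthant _)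
  -- When `x i = 0` the pyramid is degenerate and its term in the sum vanishes.
  set I : Finset (Fin (n + 1)) := Finset.univ.filter fun i => x i ≠ 0 with hI
  have hpos : ∀ i ∈ I, 0 < ε i * x i := fun i hi =>
    lt_of_le_of_ne (hε i) (mul_ne_zero (hε0 i) (Finset.mem_filter.1 hi).2).symm
  -- A point of the pyramid is `(1 - t) q + t x` with `t = y i / x i` and `q` in the open orthant,
  -- so `y i / x i` is strictly smaller than every other ratio `y k / x k`. The inequality is
  -- multiplied out because `x k` may vanish. This strict minimality makes the pyramids disjoint.
  have hcoord : ∀ i, ∀ y ∈ pyramid i x (Q i), ∀ k, k ≠ i →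
      (y i / x i) * (ε k * x k) < ε k * y k := by
    intro i y hy k hk
    obtain ⟨j, rfl⟩ := Fin.exists_succAbove_eq hk
    have h := hy.2.2 j
    simp only [Pi.smul_apply, Pi.sub_apply, smul_eq_mul] at h
    have h1 : 0 < (1 - y i / x i)⁻¹ := inv_pos.2 (sub_pos.2 hy.1.2)
    have h2 : 0 < (1 - y i / x i)⁻¹ *
        (ε (i.succAbove j) * y (i.succAbove j) -
          y i / x i * (ε (i.succAbove j) * x (i.succAbove j))) := by
      convert h using 1
      ring
    exact sub_pos.1 (pos_of_mul_pos_right h2 h1.le)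
  have hself : ∀ i ∈ I, ∀ y : Fin (n + 1) → ℝ, (y i / x i) * (ε i * x i) = ε i * y i := by
    intro i hi y
    have := (Finset.mem_filter.1 hi).2
    field_simp
  have hsub : ∀ i ∈ I, pyramid i x (Q i) ⊆ K ∩ orthant ε := by
    intro i hi y hy
    have hxi := (Finset.mem_filter.1 hi).2
    refine ⟨?_, fun k => ?_⟩
    · have h1 : 0 < 1 - y i / x i := sub_pos.2 hy.1.2
      have h2 := hconv hy.2.1 hx h1.le hy.1.1.le (by ring)
      convert h2 using 1
      refine ext_ins i ?_ fun j => ?_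
      · simp [hxi]
      · simp [mul_inv_cancel_left₀ h1.ne']
    · by_cases hk : k = i
      · subst hk
        rw [← hself k hi y]
        exact mul_pos hy.1.1 (hpos k hi)
      · exact lt_of_le_of_lt (mul_nonneg hy.1.1.le (hε k)) (hcoord i y hy k hk)
  have hdisj : (I : Set (Fin (n + 1))).PairwiseDisjoint fun i => pyramid i x (Q i) := by
    intro i hi k hk hik
    refine Set.disjoint_left.2 fun y hyi hyk => ?_
    have h1 := hcoord i y hyi k hik.symm
    have h2 := hcoord k y hyk i hik
    rw [← hself k hk y] at h1
    rw [← hself i hi y] at h2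
    have h3 := lt_of_mul_lt_mul_right h1 (hpos k hk).le
    have h4 := lt_of_mul_lt_mul_right h2 (hpos i hi).le
    exact lt_asymm h3 h4
  calc ∑ i, ENNReal.ofReal |x i| * volume (Q i)
      = ∑ i ∈ I, ENNReal.ofReal |x i| * volume (Q i) := by
        rw [hI, Finset.sum_filter]
        refine Finset.sum_congr rfl fun i _ => ?_
        split_ifs with h
        · rfl
        · simp [not_not.1 h]
    _ = ∑ i ∈ I, (n + 1) * volume (pyramid i x (Q i)) :=
        Finset.sum_congr rfl fun i hi =>
          (volume_pyramid i (Finset.mem_filter.1 hi).2 (hQ i)).symm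
    _ = (n + 1) * volume (⋃ i ∈ I, pyramid i x (Q i)) := by
        rw [measure_biUnion_finset hdisj fun i _ => measurableSet_pyramid i x (hQ i),
          Finset.mul_sum]
    _ ≤ (n + 1) * volume (K ∩ orthant ε) :=
        mul_le_mul_right (measure_mono (iUnion₂_subset hsub)) _

/-! ### Symmetric bodies, polars and the inductive inequality. -/

/-- An origin-symmetric convex body. -/
structure SymmBody {n : ℕ} (K : Set (Fin n → ℝ)) : Prop where
  convex : Convex ℝ K
  isCompact : IsCompact K
  neg_mem : ∀ x ∈ K, -x ∈ K
  mem_nhds : K ∈ nhds 0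

/-- The polar of `K` with respect to the origin and the dot product. -/
def polar {n : ℕ} (K : Set (Fin n → ℝ)) : Set (Fin n → ℝ) := {y | ∀ x ∈ K, y ⬝ᵥ x ≤ 1}

lemma polar_eq_iInter {n : ℕ} (K : Set (Fin n → ℝ)) :
    polar K = ⋂ x ∈ K, {y | y ⬝ᵥ x ≤ 1} := by
  ext y
  simp [polar]

lemma continuous_dotProduct_left {n : ℕ} (x : Fin n → ℝ) : Continuous fun y => y ⬝ᵥ x := by
  unfold dotProduct
  fun_prop

lemma isClosed_polar {n : ℕ} (K : Set (Fin n → ℝ)) : IsClosed (polar K) := by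
  rw [polar_eq_iInter]
  exact isClosed_biInter fun x _ => isClosed_le (continuous_dotProduct_left x) continuous_const

lemma convex_polar {n : ℕ} (K : Set (Fin n → ℝ)) : Convex ℝ (polar K) := by
  intro y hy z hz a b ha hb hab x hx
  rw [add_dotProduct, smul_dotProduct, smul_dotProduct, smul_eq_mul, smul_eq_mul, ← hab]
  exact add_le_add (mul_le_of_le_one_right ha (hy x hx)) (mul_le_of_le_one_right hb (hz x hx))

lemma SymmBody.isCompact_polar {n : ℕ} {K : Set (Fin n → ℝ)} (hK : SymmBody K) :
    IsCompact (polar K) := by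
  obtain ⟨r, hr, hrK⟩ := Metric.nhds_basis_closedBall.mem_iff.1 hK.mem_nhds
  refine (isCompact_box fun _ => r⁻¹).of_isClosed_subset (isClosed_polar K) fun y hy i => ?_
  have key : ∀ s, |s| = r → Pi.single i s ∈ K := fun s hs => hrK (by
    rw [mem_closedBall_zero_iff, pi_norm_le_iff_of_nonneg hr.le]
    intro j
    by_cases h : j = i
    · subst h; simp [hs]
    · simp [h, hr.le])
  have h1 := hy _ (key r (abs_of_pos hr))
  have h2 := hy _ (key (-r) (by rw [abs_neg, abs_of_pos hr]))
  rw [dotProduct_single] at h1 h2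
  rw [abs_le]
  constructor
  · rw [neg_le, ← one_div, le_div_iff₀ hr]
    linarith
  · rw [← one_div, le_div_iff₀ hr]
    linarith

lemma SymmBody.measurableSet {n : ℕ} {K : Set (Fin n → ℝ)} (hK : SymmBody K) :
    MeasurableSet K := hK.isCompact.isClosed.measurableSet

lemma SymmBody.volume_ne_top {n : ℕ} {K : Set (Fin n → ℝ)} (hK : SymmBody K) :
    volume K ≠ ⊤ := hK.isCompact.measure_lt_top.ne

lemma SymmBody.volume_pos {n : ℕ} {K : Set (Fin n → ℝ)} (hK : SymmBody K) :
    0 < volume K := Measure.measure_pos_of_mem_nhds volume hK.mem_nhds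

lemma ins_zero {n : ℕ} (i : Fin (n + 1)) : ins i 0 0 = 0 := ext_ins i (by simp) (by simp)

lemma SymmBody.slice {n : ℕ} {K : Set (Fin (n + 1) → ℝ)} (hK : SymmBody K) (i : Fin (n + 1)) :
    SymmBody (slice i K) where
  convex := by
    intro p hp q hq a b ha hb hab
    have := hK.convex hp hq ha hb hab
    rwa [← ins_smul, ← ins_smul, ← ins_add, mul_zero, mul_zero, add_zero] at this
  isCompact := by
    refine (isCompact_proj i hK.isCompact).of_isClosed_subset (hK.isCompact.isClosed.preimage
      ((continuous_ins i).comp (by fun_prop : Continuous fun p => ((0 : ℝ), p)))) ?_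
    exact fun p hp => ⟨0, hp⟩
  neg_mem := by
    intro p hp
    have := hK.neg_mem _ hp
    rw [← neg_one_smul ℝ, ← ins_smul, mul_zero, neg_one_smul] at this
    exact this
  mem_nhds := by
    have hc : Continuous fun p : Fin n → ℝ => ins i 0 p :=
      (continuous_ins i).comp (by fun_prop : Continuous fun p => ((0 : ℝ), p))
    exact hc.continuousAt.preimage_mem_nhds (by rw [ins_zero]; exact hK.mem_nhds)

/-- The polar of a section is contained in the projection of the polar (Hahn–Banach). -/
lemma SymmBody.polar_slice_subset {n : ℕ} {K : Set (Fin (n + 1) → ℝ)} (hK : SymmBody K)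
    (i : Fin (n + 1)) : polar (VolumeProduct.slice i K) ⊆ proj i (polar K) := by
  intro p hp
  have habs : Absorbent ℝ K := absorbent_nhds_zero hK.mem_nhds
  let T : (Fin (n + 1) → ℝ) →ₗ[ℝ] ℝ :=
    { toFun := fun x => p ⬝ᵥ fun j => x (i.succAbove j)
      map_add' := fun x y => dotProduct_add p _ _
      map_smul' := fun c x => dotProduct_smul c p _ }
  let f : (Fin (n + 1) → ℝ) →ₗ.[ℝ] ℝ :=
    { domain := LinearMap.ker (LinearMap.proj i : (Fin (n + 1) → ℝ) →ₗ[ℝ] ℝ)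
      toFun := T.comp (Submodule.subtype _) }
  -- The functional `p` on the hyperplane `x i = 0` is dominated there by the gauge of `K`. The
  -- value of its extension at the `i`-th basis vector is the missing coordinate of a polar point
  -- above `p`.
  obtain ⟨g, hg, hgK⟩ := exists_extension_of_le_sublinear f (gauge K)
    (fun c hc x => by rw [gauge_smul_of_nonneg hc.le, smul_eq_mul]) (gauge_add_le hK.convex habs) (by
      rintro ⟨x, hx⟩
      have hx : x i = 0 := hx
      change p ⬝ᵥ (fun j => x (i.succAbove j)) ≤ gauge K x
      refine le_of_forall_gt_imp_ge_of_dense fun a ha => ?_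
      obtain ⟨b, hb, hba, k, hk, rfl⟩ := exists_lt_of_gauge_lt habs ha
      have hki : k i = 0 := by
        simpa [hb.ne'] using hx
      have h1 : (fun j => k (i.succAbove j)) ∈ VolumeProduct.slice i K := by
        change ins i 0 _ ∈ K
        rw [← hki, ins_eta]
        exact hk
      have h2 := hp _ h1
      have h3 : p ⬝ᵥ (fun j => (b • k) (i.succAbove j)) =
          b * (p ⬝ᵥ fun j => k (i.succAbove j)) := dotProduct_smul b p _
      change p ⬝ᵥ (fun j => (b • k) (i.succAbove j)) ≤ a
      rw [h3]
      nlinarith)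
  refine ⟨g (ins i 1 0), fun x hx => ?_⟩
  have hsplit : x = x i • ins i 1 0 + ins i 0 (fun j => x (i.succAbove j)) :=
    ext_ins i (by simp) (by simp)
  have hdom : g (ins i 0 (fun j => x (i.succAbove j))) = p ⬝ᵥ fun j => x (i.succAbove j) := by
    have := hg ⟨ins i 0 (fun j => x (i.succAbove j)), by
      change ins i 0 (fun j => x (i.succAbove j)) i = 0
      simp⟩
    rw [this]
    change p ⬝ᵥ (fun j => ins i 0 (fun j => x (i.succAbove j)) (i.succAbove j)) = _
    simp
  have hgx : g x = ins i (g (ins i 1 0)) p ⬝ᵥ x := by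
    conv_lhs => rw [hsplit]
    rw [map_add, map_smul, hdom, dotProduct, dotProduct, Fin.sum_univ_succAbove _ i]
    simp [mul_comm]
  rw [← hgx]
  exact (hgK x).trans (gauge_le_one_of_mem hx)

/-- The sign vectors of length `n`. -/
noncomputable def signs (n : ℕ) : Finset (Fin n → ℝ) :=
  Fintype.piFinset fun _ => ({1, -1} : Finset ℝ)

lemma mem_signs {n : ℕ} {ε : Fin n → ℝ} : ε ∈ signs n ↔ ∀ i, ε i = 1 ∨ ε i = -1 := by
  simp [signs]

lemma card_signs (n : ℕ) : (signs n).card = 2 ^ n := by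
  have h : ({1, -1} : Finset ℝ).card = 2 := Finset.card_pair (by norm_num)
  rw [signs, Fintype.card_piFinset, Finset.prod_const, h, Finset.card_univ, Fintype.card_fin]

/-- The open orthants miss only the coordinate hyperplanes, which are null. -/
lemma volume_le_sum_orthant {n : ℕ} (S : Set (Fin n → ℝ)) :
    volume S ≤ ∑ ε ∈ signs n, volume (S ∩ orthant ε) := by
  have hnull : volume (⋃ i : Fin n, {y : Fin n → ℝ | y i = 0}) = 0 :=
    measure_iUnion_null fun i => Measure.pi_hyperplane (fun _ => volume) i 0
  have hsub : S ⊆ (⋃ ε ∈ signs n, S ∩ orthant ε) ∪ ⋃ i : Fin n, {y : Fin n → ℝ | y i = 0} := by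
    intro y hy
    by_cases h : ∃ i, y i = 0
    · exact Or.inr (mem_iUnion.2 h)
    · push Not at h
      refine Or.inl (mem_iUnion₂.2 ⟨fun i => if 0 < y i then 1 else -1, ?_, hy, fun i => ?_⟩)
      · rw [mem_signs]
        intro i
        by_cases h0 : 0 < y i <;> simp [h0]
      · by_cases h0 : 0 < y i
        · simp [h0]
        · have : y i < 0 := lt_of_le_of_ne (not_lt.1 h0) (h i)
          simp [h0, this]
  calc volume S ≤ volume (⋃ ε ∈ signs n, S ∩ orthant ε) + 0 := by
        rw [← hnull]
        exact (measure_mono hsub).trans (measure_union_le _ _)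
    _ ≤ ∑ ε ∈ signs n, volume (S ∩ orthant ε) := by
        rw [add_zero]
        exact measure_biUnion_finset_le _ _

/-- Lower bound for the volume product of a body equipartitioned by the coordinate hyperplanes. -/
theorem SymmBody.sum_volume_slice_mul_proj_le {n : ℕ} {K : Set (Fin (n + 1) → ℝ)}
    (hK : SymmBody K)
    (h : ∀ ε ∈ signs (n + 1), 2 ^ (n + 1) * volume (K ∩ orthant ε) ≤ volume K)
    (hs : ∀ i, ∀ ε ∈ signs n, volume (VolumeProduct.slice i K) ≤
      2 ^ n * volume (VolumeProduct.slice i K ∩ orthant ε)) :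
    4 * ∑ i, (volume (VolumeProduct.slice i K)).toReal * (volume (proj i (polar K))).toReal ≤
      (n + 1) ^ 2 * ((volume K).toReal * (volume (polar K)).toReal) := by
  set V := (volume K).toReal with hV
  have hVpos : 0 < V := ENNReal.toReal_pos hK.volume_pos.ne' hK.volume_ne_top
  set a : Fin (n + 1) → ℝ := fun i => (volume (VolumeProduct.slice i K)).toReal with ha
  have hafin : ∀ i, volume (VolumeProduct.slice i K) ≠ ⊤ := fun i => (hK.slice i).volume_ne_top
  -- In the pyramid inequality for the orthant of `x`, equipartition replaces each piece of a
  -- section by `2 ^ (-n)` of it and the piece of `K` by at most `2 ^ (-(n + 1))` of its volume. One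
  -- factor 2 survives.
  have hx : ∀ x ∈ K, ∑ i, 2 * |x i| * a i ≤ (n + 1) * V := by
    intro x hx
    set ε : Fin (n + 1) → ℝ := fun i => if 0 ≤ x i then 1 else -1 with hεdef
    have hε : ε ∈ signs (n + 1) := by
      rw [mem_signs]
      intro i
      by_cases h0 : 0 ≤ x i <;> simp [hεdef, h0]
    have h1 := sum_mul_volume_slice_le hK.measurableSet hK.convex hx (ε := ε) (by
      intro i
      by_cases h0 : 0 ≤ x i
      · simp [hεdef, h0]
      · simp [hεdef, h0, (not_le.1 h0).le]) (by
      intro i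
      rcases mem_signs.1 hε i with h | h <;> rw [h] <;> norm_num)
    have h2 : ∑ i, 2 * (ENNReal.ofReal |x i| * volume (VolumeProduct.slice i K)) ≤
        (n + 1) * volume K := by
      calc ∑ i, 2 * (ENNReal.ofReal |x i| * volume (VolumeProduct.slice i K))
          ≤ ∑ i, 2 * (ENNReal.ofReal |x i| * (2 ^ n * volume (VolumeProduct.slice i K ∩
              orthant fun j => ε (i.succAbove j)))) := by
            refine Finset.sum_le_sum fun i _ => ?_
            gcongr
            exact hs i _ (mem_signs.2 fun j => mem_signs.1 hε _)
        _ = 2 ^ (n + 1) * ∑ i, (ENNReal.ofReal |x i| * volume (VolumeProduct.slice i K ∩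
              orthant fun j => ε (i.succAbove j))) := by
            rw [Finset.mul_sum]
            refine Finset.sum_congr rfl fun i _ => ?_
            ring
        _ ≤ 2 ^ (n + 1) * ((n + 1) * volume (K ∩ orthant ε)) := by gcongr
        _ = (n + 1) * (2 ^ (n + 1) * volume (K ∩ orthant ε)) := by ring
        _ ≤ (n + 1) * volume K := by
            gcongr
            exact h ε hε
    have hn : (n + 1 : ℝ≥0∞) ≠ ⊤ := by finiteness
    have h3 := ENNReal.toReal_mono (ENNReal.mul_ne_top hn hK.volume_ne_top) h2
    rw [ENNReal.toReal_sum (fun i _ => by have := hafin i; finiteness), ENNReal.toReal_mul,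
      ENNReal.toReal_add (by simp) (by simp)] at h3
    refine le_trans (le_of_eq (Finset.sum_congr rfl fun i _ => ?_)) (h3.trans (le_of_eq ?_))
    · simp [ha, mul_assoc]
    · simp [hV]
  have hn : (0 : ℝ) < n + 1 := by positivity
  -- These half-widths are the coefficients of the linear inequality `hx`.
  have hbox : box (fun i => 2 * a i / ((n + 1) * V)) ⊆ polar K := by
    intro y hy x hxK
    calc y ⬝ᵥ x ≤ ∑ i, 2 * a i / ((n + 1) * V) * |x i| := by
          refine Finset.sum_le_sum fun i _ => (le_abs_self _).trans ?_
          rw [abs_mul]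
          exact mul_le_mul_of_nonneg_right (hy i) (abs_nonneg _)
      _ = (∑ i, 2 * |x i| * a i) / ((n + 1) * V) := by
          rw [Finset.sum_div]
          refine Finset.sum_congr rfl fun i _ => ?_
          ring
      _ ≤ 1 := (div_le_one (by positivity)).2 (hx x hxK)
  have h4 := sum_mul_volume_proj_le hK.isCompact_polar (convex_polar K)
    (fun i => div_nonneg (mul_nonneg zero_le_two ENNReal.toReal_nonneg) (by positivity)) hbox
  have h5 : ∑ i, 2 * (2 * a i / ((n + 1) * V)) * (volume (proj i (polar K))).toReal =
      (4 * ∑ i, a i * (volume (proj i (polar K))).toReal) / ((n + 1) * V) := by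
    rw [Finset.mul_sum, Finset.sum_div]
    refine Finset.sum_congr rfl fun i _ => ?_
    ring
  rw [h5, div_le_iff₀ (by positivity)] at h4
  linarith

/-- The inductive step for volume products of equipartitioned bodies. -/
theorem SymmBody.le_volume_mul_volume_polar {n : ℕ} {K : Set (Fin (n + 1) → ℝ)}
    (hK : SymmBody K) {m : ℝ}
    (hm : ∀ S : Set (Fin n → ℝ), SymmBody S → m ≤ (volume S).toReal * (volume (polar S)).toReal)
    (h : ∀ ε ∈ signs (n + 1), 2 ^ (n + 1) * volume (K ∩ orthant ε) ≤ volume K)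
    (hs : ∀ i, ∀ ε ∈ signs n, volume (VolumeProduct.slice i K) ≤
      2 ^ n * volume (VolumeProduct.slice i K ∩ orthant ε)) :
    4 * m / (n + 1) ≤ (volume K).toReal * (volume (polar K)).toReal := by
  have h1 := hK.sum_volume_slice_mul_proj_le h hs
  have h2 : (n + 1) * m ≤ ∑ i, (volume (VolumeProduct.slice i K)).toReal *
      (volume (proj i (polar K))).toReal := by
    calc (n + 1) * m = ∑ _i : Fin (n + 1), m := by simp
      _ ≤ _ := Finset.sum_le_sum fun i _ => (hm _ (hK.slice i)).trans <| by
        refine mul_le_mul_of_nonneg_left ?_ ENNReal.toReal_nonneg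
        exact ENNReal.toReal_mono (isCompact_proj i hK.isCompact_polar).measure_lt_top.ne
          (measure_mono (hK.polar_slice_subset i))
  have hn : (0 : ℝ) < n + 1 := by positivity
  rw [div_le_iff₀ hn]
  nlinarith

/-! ### Equipartition of two even planar densities by a pair of lines. -/

/-- Two continuous circle-measures can be halved simultaneously by a pair of lines. -/
lemma exists_simultaneous_halving {M N : ℝ → ℝ} (hM : Continuous M) (hN : Continuous N)
    (hmono : StrictMono M) {T m n : ℝ} (hT : 0 < T) (hMT : ∀ t, M (t + T) = M t + m)
    (hNT : ∀ t, N (t + T) = N t + n) :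
    ∃ a b, a < b ∧ b < a + T ∧ M b = M a + m / 2 ∧ N b = N a + n / 2 := by
  have hm : 0 < m := by
    have h1 := hMT 0
    have h2 : M 0 < M (0 + T) := hmono (by linarith)
    linarith
  -- Along multiples of the period `M` is unbounded in both directions, hence surjective and
  -- invertible.
  have hMk : ∀ k : ℕ, M (k * T) = M 0 + k * m ∧ M (-(k * T)) = M 0 - k * m := by
    intro k
    induction k with
    | zero => simp
    | succ k ih =>
      push_cast
      constructor
      · rw [add_mul, one_mul, hMT, ih.1]; ring
      · have := hMT (-((k + 1) * T))
        rw [show -(((k : ℝ) + 1) * T) + T = -(k * T) by ring, ih.2] at this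
        linarith
  have hsurj : Function.Surjective M := by
    intro y
    obtain ⟨k, hk⟩ := exists_nat_ge (|y - M 0| / m)
    rw [div_le_iff₀ hm, abs_le] at hk
    exact mem_range_of_exists_le_of_exists_ge hM ⟨_, by rw [(hMk k).2]; linarith⟩
      ⟨_, by rw [(hMk k).1]; linarith⟩
  let e : ℝ ≃o ℝ := hmono.orderIsoOfSurjective M hsurj
  have he : ∀ y, M (e.symm y) = y := fun y => e.apply_symm_apply y
  -- `φ t` is the point at which half the mass of a period has accumulated from `t`; applying it
  -- twice advances by a full period.
  let φ : ℝ → ℝ := fun t => e.symm (M t + m / 2)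
  have hφ : Continuous φ := e.symm.continuous.comp (by fun_prop)
  have hMφ : ∀ t, M (φ t) = M t + m / 2 := fun t => he _
  have hφφ : ∀ t, φ (φ t) = t + T := fun t => hmono.injective (by
    rw [hMφ, hMφ, hMT]; ring)
  -- The error in halving `N` changes sign between `0` and `φ 0`, so it has a zero.
  let F : ℝ → ℝ := fun t => N (φ t) - N t - n / 2
  have hF : Continuous F := by fun_prop
  have hFφ : F (φ 0) = -F 0 := by
    simp only [F, hφφ, hNT]
    ring
  obtain ⟨a, ha⟩ : ∃ a, F a = 0 := by
    rcases le_total (F 0) 0 with h | h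
    · exact mem_range_of_exists_le_of_exists_ge hF ⟨0, h⟩ ⟨φ 0, by rw [hFφ]; linarith⟩
    · exact mem_range_of_exists_le_of_exists_ge hF ⟨φ 0, by rw [hFφ]; linarith⟩ ⟨0, h⟩
  refine ⟨a, φ a, hmono.lt_iff_lt.1 ?_, hmono.lt_iff_lt.1 ?_, hMφ a, ?_⟩
  · rw [hMφ]; linarith
  · rw [hMφ, hMT]; linarith
  · have : N (φ a) - N a - n / 2 = 0 := ha
    linarith

/-- The angular density of `f` in polar coordinates. -/
noncomputable def angularDensity (f : ℝ × ℝ → ℝ≥0∞) (θ : ℝ) : ℝ≥0∞ :=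
  ∫⁻ r in Ioi (0 : ℝ), ENNReal.ofReal r * f (r * Real.cos θ, r * Real.sin θ)

lemma measurable_angularDensity {f : ℝ × ℝ → ℝ≥0∞} (hf : Measurable f) :
    Measurable (angularDensity f) := by
  unfold angularDensity
  apply Measurable.lintegral_prod_right' (f := fun q : ℝ × ℝ =>
    ENNReal.ofReal q.2 * f (q.2 * Real.cos q.1, q.2 * Real.sin q.1))
  fun_prop

lemma angularDensity_add_pi {f : ℝ × ℝ → ℝ≥0∞} (heven : ∀ p, f (-p) = f p) (θ : ℝ) :
    angularDensity f (θ + Real.pi) = angularDensity f θ := by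
  unfold angularDensity
  congr 1
  funext r
  rw [Real.cos_add_pi, Real.sin_add_pi, ← heven]
  simp

/-- Integration over a cone in terms of the angular density. -/
lemma setLIntegral_cone {f : ℝ × ℝ → ℝ≥0∞} (hf : Measurable f) {S : Set (ℝ × ℝ)}
    (hS : MeasurableSet S)
    (hcone : ∀ r θ, 0 < r → ((r * Real.cos θ, r * Real.sin θ) ∈ S ↔
      (Real.cos θ, Real.sin θ) ∈ S)) :
    ∫⁻ p in S, f p = ∫⁻ θ in Ioo (-Real.pi) Real.pi,
      {θ | (Real.cos θ, Real.sin θ) ∈ S}.indicator (angularDensity f) θ := by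
  rw [← lintegral_indicator hS, ← lintegral_comp_polarCoord_symm, polarCoord_target,
    Measure.volume_eq_prod, ← Measure.prod_restrict]
  have hmeas : Measurable fun p : ℝ × ℝ => ENNReal.ofReal p.1 •
      S.indicator f (polarCoord.symm p) := by
    simp only [polarCoord_symm_apply, smul_eq_mul]
    have := hf.indicator hS
    fun_prop
  rw [lintegral_prod_symm _ hmeas.aemeasurable]
  refine lintegral_congr fun θ => ?_
  by_cases hθ : (Real.cos θ, Real.sin θ) ∈ S
  · rw [indicator_of_mem (by exact hθ)]
    refine setLIntegral_congr_fun measurableSet_Ioi fun r hr => ?_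
    have : (r * Real.cos θ, r * Real.sin θ) ∈ S := (hcone r θ hr).2 hθ
    simp [polarCoord_symm_apply, indicator_of_mem this]
  · rw [indicator_of_notMem (by exact hθ)]
    refine (setLIntegral_congr_fun (g := fun _ => 0) measurableSet_Ioi fun r hr => ?_).trans
      (by simp)
    have : (r * Real.cos θ, r * Real.sin θ) ∉ S := fun h => hθ ((hcone r θ hr).1 h)
    simp [polarCoord_symm_apply, indicator_of_notMem this]

/-- Both intervals are fundamental domains for translation by multiples of `T`. -/
lemma setLIntegral_Ioc_eq_of_periodic {g : ℝ → ℝ≥0∞} {T : ℝ} (hT : 0 < T)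
    (hg : Function.Periodic g T) (t s : ℝ) :
    ∫⁻ x in Ioc t (t + T), g x = ∫⁻ x in Ioc s (s + T), g x := by
  have : VAddInvariantMeasure (AddSubgroup.zmultiples T) ℝ volume :=
    ⟨fun c s _ => measure_preimage_add _ _ _⟩
  apply IsAddFundamentalDomain.setLIntegral_eq (G := AddSubgroup.zmultiples T)
  exacts [isAddFundamentalDomain_Ioc hT t, isAddFundamentalDomain_Ioc hT s,
    hg.map_vadd_zmultiples]

/-- The open sector of directions with angle between `a` and `b`. -/
def sector (a b : ℝ) : Set (ℝ × ℝ) :=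
  {p | 0 < Real.sin b * p.1 - Real.cos b * p.2 ∧ 0 < Real.cos a * p.2 - Real.sin a * p.1}

lemma measurableSet_sector (a b : ℝ) : MeasurableSet (sector a b) := by
  have h1 : MeasurableSet {p : ℝ × ℝ | 0 < Real.sin b * p.1 - Real.cos b * p.2} :=
    measurableSet_lt measurable_const (by fun_prop)
  have h2 : MeasurableSet {p : ℝ × ℝ | 0 < Real.cos a * p.2 - Real.sin a * p.1} :=
    measurableSet_lt measurable_const (by fun_prop)
  exact h1.inter h2

lemma setLIntegral_sector {f : ℝ × ℝ → ℝ≥0∞} (hf : Measurable f) (heven : ∀ p, f (-p) = f p)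
    {a b : ℝ} (hab : a < b) (hba : b < a + Real.pi) :
    ∫⁻ p in sector a b, f p = ∫⁻ θ in Ioc a b, angularDensity f θ := by
  have hpi := Real.pi_pos
  -- The angle `θ` is tested by the signs of two sines. On the full turn starting at `a` both are
  -- positive exactly between `a` and `b`, since `b - a < π`; periodicity moves the polar-coordinate
  -- range to that turn.
  have hmem : ∀ θ, (Real.cos θ, Real.sin θ) ∈ sector a b ↔
      0 < Real.sin (b - θ) ∧ 0 < Real.sin (θ - a) := by
    intro θ
    simp only [sector, mem_ofPred_eq, Real.sin_sub]
    constructor <;> rintro ⟨h1, h2⟩ <;> constructor <;> linarith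
  rw [setLIntegral_cone hf (measurableSet_sector a b)]
  swap
  · intro r θ hr
    have h1 : Real.sin b * (r * Real.cos θ) - Real.cos b * (r * Real.sin θ) =
      r * (Real.sin b * Real.cos θ - Real.cos b * Real.sin θ) := by ring
    have h2 : Real.cos a * (r * Real.sin θ) - Real.sin a * (r * Real.cos θ) =
      r * (Real.cos a * Real.sin θ - Real.sin a * Real.cos θ) := by ring
    simp only [sector, mem_ofPred_eq, h1, h2, mul_pos_iff_of_pos_left hr]
  set g := {θ | (Real.cos θ, Real.sin θ) ∈ sector a b}.indicator (angularDensity f) with hg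
  have hper : Function.Periodic g (2 * Real.pi) := by
    intro θ
    have h1 : θ + 2 * Real.pi ∈ {θ | (Real.cos θ, Real.sin θ) ∈ sector a b} ↔
        θ ∈ {θ | (Real.cos θ, Real.sin θ) ∈ sector a b} := by
      simp only [mem_ofPred_eq, Real.cos_add_two_pi, Real.sin_add_two_pi]
    have h2 : angularDensity f (θ + 2 * Real.pi) = angularDensity f θ := by
      rw [two_mul, ← add_assoc, angularDensity_add_pi heven, angularDensity_add_pi heven]
    by_cases h : θ ∈ {θ | (Real.cos θ, Real.sin θ) ∈ sector a b}
    · rw [hg, indicator_of_mem h, indicator_of_mem (h1.2 h), h2]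
    · rw [hg, indicator_of_notMem h, indicator_of_notMem fun h' => h (h1.1 h')]
  have h1 : ∫⁻ θ in Ioo (-Real.pi) Real.pi, g θ = ∫⁻ θ in Ioc a (a + 2 * Real.pi), g θ := by
    rw [setLIntegral_congr Ioo_ae_eq_Ioc, ← setLIntegral_Ioc_eq_of_periodic (by positivity) hper
      (-Real.pi)]
    congr 3
    ring
  rw [h1, setLIntegral_congr (Ioo_ae_eq_Ioc (a := a) (b := b)).symm,
    ← lintegral_indicator measurableSet_Ioc, ← lintegral_indicator measurableSet_Ioo]
  refine lintegral_congr fun θ => ?_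
  by_cases hθ : θ ∈ Ioo a b
  · have h2 : θ ∈ {θ | (Real.cos θ, Real.sin θ) ∈ sector a b} := by
      rw [mem_ofPred_eq, hmem]
      constructor
      · exact Real.sin_pos_of_pos_of_lt_pi (by linarith [hθ.2]) (by linarith [hθ.1])
      · exact Real.sin_pos_of_pos_of_lt_pi (by linarith [hθ.1]) (by linarith [hθ.2])
    have h3 : θ ∈ Ioc a (a + 2 * Real.pi) := ⟨hθ.1, by linarith [hθ.2]⟩
    rw [indicator_of_mem hθ, indicator_of_mem h3, hg, indicator_of_mem h2]
  · rw [indicator_of_notMem hθ]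
    by_cases h3 : θ ∈ Ioc a (a + 2 * Real.pi)
    · rw [indicator_of_mem h3, hg, indicator_of_notMem]
      rw [mem_ofPred_eq, hmem]
      rintro ⟨h4, h5⟩
      have h6 : θ < a + Real.pi := by
        by_contra h6
        have := Real.sin_nonpos_of_nonpos_of_neg_pi_le (x := θ - a - 2 * Real.pi)
          (by linarith [h3.2]) (by linarith)
        rw [Real.sin_sub_two_pi] at this
        linarith
      have h7 : b ≤ θ := by
        by_contra h7
        exact hθ ⟨h3.1, not_le.1 h7⟩
      have := Real.sin_nonpos_of_nonpos_of_neg_pi_le (x := b - θ) (by linarith) (by linarith)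
      linarith
    · rw [indicator_of_notMem h3]

lemma lintegral_eq_angularDensity {f : ℝ × ℝ → ℝ≥0∞} (hf : Measurable f) :
    ∫⁻ p, f p = ∫⁻ θ in Ioc (-Real.pi) Real.pi, angularDensity f θ := by
  rw [← setLIntegral_univ, setLIntegral_cone hf MeasurableSet.univ (by simp),
    setLIntegral_congr Ioo_ae_eq_Ioc]
  simp

lemma angularDensity_le {f : ℝ × ℝ → ℝ≥0∞} {C : ℝ≥0∞} {R : ℝ}
    (hC : ∀ p, f p ≤ C) (hR : ∀ p, R < ‖p‖ → f p = 0) (θ : ℝ) :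
    angularDensity f θ ≤ ENNReal.ofReal (2 * R) * C * ENNReal.ofReal (2 * R) := by
  calc angularDensity f θ
      ≤ ∫⁻ r in Ioi (0 : ℝ), (Ioc 0 (2 * R)).indicator
          (fun _ => ENNReal.ofReal (2 * R) * C) r := by
        refine setLIntegral_mono' measurableSet_Ioi fun r hr => ?_
        have hr : 0 < r := hr
        by_cases h : r ≤ 2 * R
        · have h' : r ∈ Ioc 0 (2 * R) := ⟨hr, h⟩
          rw [indicator_of_mem h']
          gcongr
          exact hC _
        · rw [hR, mul_zero]
          · exact zero_le
          rw [Prod.norm_mk, lt_sup_iff, Real.norm_eq_abs, Real.norm_eq_abs, abs_mul, abs_mul,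
            abs_of_pos hr]
          by_contra hcon
          push Not at hcon h
          -- The norm of `ℝ × ℝ` is the sup norm. As `|cos θ| + |sin θ| ≥ 1`, the point at radius
          -- `r` has norm at least `r / 2`, whence the cutoff `2 * R`.
          have h1 : r * 1 ≤ r * (|Real.cos θ| + |Real.sin θ|) := by
            refine mul_le_mul_of_nonneg_left ?_ hr.le
            have h2 := Real.sin_sq_add_cos_sq θ
            rw [← sq_abs (Real.sin θ), ← sq_abs (Real.cos θ)] at h2
            nlinarith [abs_nonneg (Real.cos θ), abs_nonneg (Real.sin θ)]
          linarith [hcon.1, hcon.2]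
    _ ≤ ∫⁻ r, (Ioc 0 (2 * R)).indicator (fun _ => ENNReal.ofReal (2 * R) * C) r :=
        setLIntegral_le_lintegral _ _
    _ = ENNReal.ofReal (2 * R) * C * ENNReal.ofReal (2 * R) := by
        rw [lintegral_indicator_const measurableSet_Ioc, Real.volume_Ioc, sub_zero]

/-- Every ray spends the radii from `r₀ / 2` to `r₀` in the region where `f ≥ c`. This makes the
angular mass strictly increasing. -/
lemma angularDensity_pos {f : ℝ × ℝ → ℝ≥0∞} {c : ℝ≥0∞} (hc : c ≠ 0) {r₀ : ℝ} (hr₀ : 0 < r₀)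
    (hf : ∀ p, ‖p‖ < r₀ → c ≤ f p) (θ : ℝ) : 0 < angularDensity f θ := by
  calc 0 < ∫⁻ _ in Ioo (r₀ / 2) r₀, ENNReal.ofReal (r₀ / 2) * c := by
        rw [setLIntegral_const, Real.volume_Ioo]
        have h1 : ENNReal.ofReal (r₀ / 2) ≠ 0 := by simpa using hr₀
        have h2 : ENNReal.ofReal (r₀ - r₀ / 2) ≠ 0 := by simpa using hr₀
        exact pos_iff_ne_zero.2 (mul_ne_zero (mul_ne_zero h1 hc) h2)
    _ ≤ ∫⁻ r in Ioo (r₀ / 2) r₀, ENNReal.ofReal r * f (r * Real.cos θ, r * Real.sin θ) := by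
        refine setLIntegral_mono' measurableSet_Ioo fun r hr => ?_
        have hr0 : 0 < r := by linarith [hr.1]
        refine mul_le_mul' (ENNReal.ofReal_le_ofReal hr.1.le) (hf _ ?_)
        rw [Prod.norm_mk, sup_lt_iff, Real.norm_eq_abs, Real.norm_eq_abs, abs_mul, abs_mul,
          abs_of_pos hr0]
        have h1 := mul_le_mul_of_nonneg_left (Real.abs_cos_le_one θ) hr0.le
        have h2 := mul_le_mul_of_nonneg_left (Real.abs_sin_le_one θ) hr0.le
        constructor <;> linarith [hr.2]
    _ ≤ angularDensity f θ :=
        lintegral_mono_set fun r hr => by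
          have := hr.1
          exact mem_Ioi.2 (by linarith)

/-- The mass of `f` in the sector of angles between `0` and `θ`, continued to all real `θ`. -/
noncomputable def angularMass (f : ℝ × ℝ → ℝ≥0∞) (θ : ℝ) : ℝ :=
  ∫ t in (0 : ℝ)..θ, (angularDensity f t).toReal

section

variable {f : ℝ × ℝ → ℝ≥0∞} {C : ℝ≥0∞} {R : ℝ}

lemma angularDensity_ne_top (hC : C ≠ ⊤) (hfC : ∀ p, f p ≤ C) (hfR : ∀ p, R < ‖p‖ → f p = 0)
    (θ : ℝ) : angularDensity f θ ≠ ⊤ :=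
  ne_top_of_le_ne_top (by finiteness) (angularDensity_le hfC hfR θ)

lemma intervalIntegrable_angularDensity (hf : Measurable f) (hC : C ≠ ⊤) (hfC : ∀ p, f p ≤ C)
    (hfR : ∀ p, R < ‖p‖ → f p = 0) (a b : ℝ) :
    IntervalIntegrable (fun t => (angularDensity f t).toReal) volume a b := by
  refine (intervalIntegrable_const (c := (ENNReal.ofReal (2 * R) * C *
    ENNReal.ofReal (2 * R)).toReal)).mono_fun
    (measurable_angularDensity hf).ennreal_toReal.aestronglyMeasurable ?_
  refine Filter.Eventually.of_forall fun t => ?_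
  simp only [Real.norm_eq_abs, ENNReal.abs_toReal]
  exact ENNReal.toReal_mono (by finiteness) (angularDensity_le hfC hfR t)

lemma continuous_angularMass (hf : Measurable f) (hC : C ≠ ⊤) (hfC : ∀ p, f p ≤ C)
    (hfR : ∀ p, R < ‖p‖ → f p = 0) : Continuous (angularMass f) :=
  intervalIntegral.continuous_primitive (intervalIntegrable_angularDensity hf hC hfC hfR) 0

lemma lintegral_angularDensity (hf : Measurable f) (hC : C ≠ ⊤) (hfC : ∀ p, f p ≤ C)
    (hfR : ∀ p, R < ‖p‖ → f p = 0) {a b : ℝ} (hab : a ≤ b) :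
    ∫⁻ θ in Ioc a b, angularDensity f θ = ENNReal.ofReal (angularMass f b - angularMass f a) := by
  have hint := intervalIntegrable_angularDensity hf hC hfC hfR
  rw [angularMass, angularMass, intervalIntegral.integral_interval_sub_left (hint _ _) (hint _ _),
    intervalIntegral.integral_of_le hab, ofReal_integral_eq_lintegral_ofReal (hint a b).1
      (Filter.Eventually.of_forall fun _ => ENNReal.toReal_nonneg)]
  refine lintegral_congr fun θ => ?_
  rw [ENNReal.ofReal_toReal (angularDensity_ne_top hC hfC hfR θ)]

/-- Evenness makes the angular density `π`-periodic, so a half-turn always has the same mass and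
lines through the origin bisect. -/
lemma angularMass_add_pi (hf : Measurable f) (heven : ∀ p, f (-p) = f p) (hC : C ≠ ⊤)
    (hfC : ∀ p, f p ≤ C) (hfR : ∀ p, R < ‖p‖ → f p = 0) (θ : ℝ) :
    angularMass f (θ + Real.pi) = angularMass f θ + angularMass f Real.pi := by
  have hint := intervalIntegrable_angularDensity hf hC hfC hfR
  have hper : Function.Periodic (fun t => (angularDensity f t).toReal) Real.pi := fun t => by
    simp only [angularDensity_add_pi heven]
  have h := hper.intervalIntegral_add_eq θ 0
  rw [zero_add] at h
  rw [angularMass, angularMass, angularMass, ← h,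
    intervalIntegral.integral_add_adjacent_intervals (hint _ _) (hint _ _)]

lemma strictMono_angularMass (hf : Measurable f) (hC : C ≠ ⊤) (hfC : ∀ p, f p ≤ C)
    (hfR : ∀ p, R < ‖p‖ → f p = 0) {c : ℝ≥0∞} (hc : c ≠ 0) {r₀ : ℝ} (hr₀ : 0 < r₀)
    (hfc : ∀ p, ‖p‖ < r₀ → c ≤ f p) : StrictMono (angularMass f) := by
  intro a b hab
  have hint := intervalIntegrable_angularDensity hf hC hfC hfR
  rw [← sub_pos, angularMass, angularMass,
    intervalIntegral.integral_interval_sub_left (hint _ _) (hint _ _)]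
  refine intervalIntegral.intervalIntegral_pos_of_pos (hint a b) (fun t => ?_) hab
  exact ENNReal.toReal_pos (angularDensity_pos hc hr₀ hfc t).ne'
    (angularDensity_ne_top hC hfC hfR t)

lemma lintegral_eq_angularMass (hf : Measurable f) (heven : ∀ p, f (-p) = f p) (hC : C ≠ ⊤)
    (hfC : ∀ p, f p ≤ C) (hfR : ∀ p, R < ‖p‖ → f p = 0) :
    ∫⁻ p, f p = 4 * ENNReal.ofReal (angularMass f Real.pi / 2) := by
  have h0 : angularMass f 0 = 0 := by simp [angularMass]
  have h1 := angularMass_add_pi hf heven hC hfC hfR (-Real.pi)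
  rw [neg_add_cancel, h0] at h1
  rw [lintegral_eq_angularDensity hf, lintegral_angularDensity hf hC hfC hfR
    (by linarith [Real.pi_pos]), show (4 : ℝ≥0∞) = ENNReal.ofReal 4 by simp,
    ← ENNReal.ofReal_mul (by norm_num)]
  congr 1
  linarith

/-- A sector with half the mass of a half-turn has a quarter of the total mass. -/
lemma four_mul_setLIntegral_sector (hf : Measurable f) (heven : ∀ p, f (-p) = f p) (hC : C ≠ ⊤)
    (hfC : ∀ p, f p ≤ C) (hfR : ∀ p, R < ‖p‖ → f p = 0) {a b : ℝ} (hab : a < b)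
    (hba : b < a + Real.pi) (h : angularMass f b = angularMass f a + angularMass f Real.pi / 2) :
    4 * ∫⁻ p in sector a b, f p = ∫⁻ p, f p := by
  rw [setLIntegral_sector hf heven hab hba, lintegral_angularDensity hf hC hfC hfR hab.le, h,
    lintegral_eq_angularMass hf heven hC hfC hfR]
  congr 2
  ring

end

lemma setLIntegral_neg {f : ℝ × ℝ → ℝ≥0∞} (heven : ∀ p, f (-p) = f p) {S T : Set (ℝ × ℝ)}
    (hT : MeasurableSet T) (h : ∀ p, -p ∈ T ↔ p ∈ S) :
    ∫⁻ p in S, f p = ∫⁻ p in T, f p := by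
  have hS : S = (Neg.neg : ℝ × ℝ → ℝ × ℝ) ⁻¹' T := by
    ext p
    exact (h p).symm
  have hS' : MeasurableSet S := by
    rw [hS]
    exact measurable_neg hT
  rw [← lintegral_indicator hT, ← lintegral_indicator hS',
    ← lintegral_neg_eq_self (T.indicator f)]
  refine lintegral_congr fun p => ?_
  by_cases hp : p ∈ S
  · rw [indicator_of_mem hp, indicator_of_mem ((h p).2 hp), heven]
  · rw [indicator_of_notMem hp, indicator_of_notMem fun h' => hp ((h p).1 h')]

/-- Bounded even densities with bounded support. -/
structure EvenDensity (f : (Fin 2 → ℝ) → ℝ≥0∞) : Prop where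
  measurable : Measurable f
  even : ∀ p, f (-p) = f p
  bounded : ∃ C : ℝ≥0∞, C ≠ ⊤ ∧ ∀ p, f p ≤ C
  support : ∃ R : ℝ, ∀ p, R < ‖p‖ → f p = 0

/-- Two even densities in the plane are equipartitioned by a common pair of lines. -/
theorem exists_matrix_equipartition {f g : (Fin 2 → ℝ) → ℝ≥0∞} (hf : EvenDensity f)
    (hg : EvenDensity g) {c : ℝ≥0∞} (hc : c ≠ 0) {r₀ : ℝ} (hr₀ : 0 < r₀)
    (hfc : ∀ p, ‖p‖ < r₀ → c ≤ f p) :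
    ∃ A : Matrix (Fin 2) (Fin 2) ℝ, A.det ≠ 0 ∧ ∀ ε ∈ signs 2,
      4 * ∫⁻ p in {p | A.mulVec p ∈ orthant ε}, f p = ∫⁻ p, f p ∧
      4 * ∫⁻ p in {p | A.mulVec p ∈ orthant ε}, g p = ∫⁻ p, g p := by
  let e : (Fin 2 → ℝ) ≃ᵐ ℝ × ℝ := MeasurableEquiv.finTwoArrow
  have he : MeasurePreserving e volume volume := volume_preserving_finTwoArrow ℝ
  have hes : ∀ q : ℝ × ℝ, e.symm q = ![q.1, q.2] := fun q => rfl
  have hneg : ∀ q : ℝ × ℝ, e.symm (-q) = -e.symm q := fun q => by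
    simp [hes]
  have hnorm : ∀ q : ℝ × ℝ, ‖e.symm q‖ = ‖q‖ := fun q => by
    apply le_antisymm
    · rw [hes, pi_norm_le_iff_of_nonneg (norm_nonneg _)]
      intro i
      fin_cases i
      · exact norm_fst_le q
      · exact norm_snd_le q
    · rw [Prod.norm_def]
      exact sup_le (norm_le_pi_norm (e.symm q) 0) (norm_le_pi_norm (e.symm q) 1)
  obtain ⟨Cf, hCf, hfC⟩ := hf.bounded
  obtain ⟨Cg, hCg, hgC⟩ := hg.bounded
  obtain ⟨Rf, hfR⟩ := hf.support
  obtain ⟨Rg, hgR⟩ := hg.support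
  have hf1 : Measurable fun q => f (e.symm q) := hf.measurable.comp e.symm.measurable
  have hg1 : Measurable fun q => g (e.symm q) := hg.measurable.comp e.symm.measurable
  have hf2 : ∀ q, f (e.symm (-q)) = f (e.symm q) := fun q => by rw [hneg, hf.even]
  have hg2 : ∀ q, g (e.symm (-q)) = g (e.symm q) := fun q => by rw [hneg, hg.even]
  have hf3 : ∀ q, f (e.symm q) ≤ Cf := fun q => hfC _
  have hg3 : ∀ q, g (e.symm q) ≤ Cg := fun q => hgC _
  have hf4 : ∀ q, Rf < ‖q‖ → f (e.symm q) = 0 := fun q hq => hfR _ (by rwa [hnorm])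
  have hg4 : ∀ q, Rg < ‖q‖ → g (e.symm q) = 0 := fun q hq => hgR _ (by rwa [hnorm])
  obtain ⟨a, b, hab, hba, hFab, hGab⟩ := exists_simultaneous_halving
    (continuous_angularMass hf1 hCf hf3 hf4) (continuous_angularMass hg1 hCg hg3 hg4)
    (strictMono_angularMass hf1 hCf hf3 hf4 hc hr₀ fun q hq => hfc _ (by rwa [hnorm]))
    Real.pi_pos (angularMass_add_pi hf1 hf2 hCf hf3 hf4) (angularMass_add_pi hg1 hg2 hCg hg3 hg4)
  -- The rows of the matrix are normals to the lines at angles `b` and `a`. The four sign patterns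
  -- give the sectors `(a, b)`, `(b, a + π)` and their negatives, which carry equal mass by
  -- evenness.
  have key : ∀ {u : (Fin 2 → ℝ) → ℝ≥0∞} {C : ℝ≥0∞} {R : ℝ},
      Measurable (fun q => u (e.symm q)) → (∀ q, u (e.symm (-q)) = u (e.symm q)) → C ≠ ⊤ →
      (∀ q, u (e.symm q) ≤ C) → (∀ q, R < ‖q‖ → u (e.symm q) = 0) →
      angularMass (fun q => u (e.symm q)) b = angularMass (fun q => u (e.symm q)) a +
        angularMass (fun q => u (e.symm q)) Real.pi / 2 →
      ∀ ε ∈ signs 2,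
        4 * ∫⁻ p in {p | !![Real.sin b, -Real.cos b; -Real.sin a, Real.cos a].mulVec p ∈
          orthant ε}, u p = ∫⁻ p, u p := by
    intro u C R h1 h2 hC h3 h4 hmass ε hε
    have s1 := four_mul_setLIntegral_sector h1 h2 hC h3 h4 hab hba hmass
    have s2 := four_mul_setLIntegral_sector h1 h2 hC h3 h4 hba (by linarith)
      (by rw [angularMass_add_pi h1 h2 hC h3 h4 a, hmass]; ring)
    have t1 : ∫⁻ p, u p = ∫⁻ q, u (e.symm q) :=
      (he.symm.lintegral_comp_emb e.symm.measurableEmbedding u).symm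
    have t2 : ∫⁻ p in {p | !![Real.sin b, -Real.cos b; -Real.sin a, Real.cos a].mulVec p ∈
          orthant ε}, u p = ∫⁻ q in {q : ℝ × ℝ |
            0 < ε 0 * (Real.sin b * q.1 - Real.cos b * q.2) ∧
            0 < ε 1 * (Real.cos a * q.2 - Real.sin a * q.1)}, u (e.symm q) := by
      rw [← he.symm.setLIntegral_comp_preimage_emb e.symm.measurableEmbedding]
      congr 2
      ext q
      simp only [mem_preimage, mem_ofPred_eq, orthant, Fin.forall_fin_two, hes]
      simp only [Matrix.cons_mulVec, Matrix.cons_dotProduct, Matrix.cons_val_zero,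
        Matrix.cons_val_one, Matrix.dotProduct_of_isEmpty, Matrix.empty_mulVec]
      simp [Matrix.vecHead, Matrix.vecTail, sub_eq_add_neg, add_comm]
    rw [t1, t2]
    rcases mem_signs.1 hε 0 with e0 | e0 <;> rcases mem_signs.1 hε 1 with e1 | e1 <;> rw [e0, e1]
    · rw [← s1]
      simp only [one_mul]
      rfl
    · rw [← s2, setLIntegral_neg h2 (measurableSet_sector _ _)]
      intro p
      simp only [sector, mem_ofPred_eq, Real.sin_add_pi, Real.cos_add_pi, Prod.fst_neg,
        Prod.snd_neg]
      constructor <;> rintro ⟨h1, h2⟩ <;> constructor <;> linarith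
    · rw [← s2]
      congr 3
      ext p
      simp only [sector, mem_ofPred_eq, Real.sin_add_pi, Real.cos_add_pi]
      constructor <;> rintro ⟨h1, h2⟩ <;> constructor <;> linarith
    · rw [← s1, setLIntegral_neg h2 (measurableSet_sector _ _)]
      intro p
      simp only [sector, mem_ofPred_eq, Prod.fst_neg, Prod.snd_neg]
      constructor <;> rintro ⟨h1, h2⟩ <;> constructor <;> linarith
  refine ⟨!![Real.sin b, -Real.cos b; -Real.sin a, Real.cos a], ?_, fun ε hε =>
    ⟨key hf1 hf2 hCf hf3 hf4 hFab ε hε, key hg1 hg2 hCg hg3 hg4 hGab ε hε⟩⟩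
  have h : (!![Real.sin b, -Real.cos b; -Real.sin a, Real.cos a]).det = Real.sin (b - a) := by
    rw [Matrix.det_fin_two_of, Real.sin_sub]
    ring
  rw [h]
  exact (Real.sin_pos_of_pos_of_lt_pi (by linarith) (by linarith)).ne'

/-! ### Linear changes of coordinates and sign changes. -/

lemma volume_preimage_mulVec {n : ℕ} {B : Matrix (Fin n) (Fin n) ℝ} (hB : B.det ≠ 0)
    (S : Set (Fin n → ℝ)) :
    volume {x | B.mulVec x ∈ S} = ENNReal.ofReal |B.det⁻¹| * volume S := by
  have h : LinearMap.det (Matrix.toLin' B) = B.det := LinearMap.det_toLin' B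
  have := Measure.addHaar_preimage_linearMap volume (f := Matrix.toLin' B) (by rwa [h]) S
  rw [h] at this
  exact this

lemma mulVec_inv_mulVec {n : ℕ} {B : Matrix (Fin n) (Fin n) ℝ} (hB : B.det ≠ 0)
    (x : Fin n → ℝ) : B.mulVec (B⁻¹.mulVec x) = x := by
  rw [Matrix.mulVec_mulVec, Matrix.mul_nonsing_inv _ (isUnit_iff_ne_zero.2 hB), Matrix.one_mulVec]

lemma inv_mulVec_mulVec {n : ℕ} {B : Matrix (Fin n) (Fin n) ℝ} (hB : B.det ≠ 0)
    (x : Fin n → ℝ) : B⁻¹.mulVec (B.mulVec x) = x := by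
  rw [Matrix.mulVec_mulVec, Matrix.nonsing_inv_mul _ (isUnit_iff_ne_zero.2 hB), Matrix.one_mulVec]

lemma det_inv_ne_zero {n : ℕ} {B : Matrix (Fin n) (Fin n) ℝ} (hB : B.det ≠ 0) :
    B⁻¹.det ≠ 0 := by
  rw [Matrix.det_nonsing_inv, Ring.inverse_eq_inv']
  exact inv_ne_zero hB

lemma SymmBody.preimage_mulVec {n : ℕ} {K : Set (Fin n → ℝ)} (hK : SymmBody K)
    {B : Matrix (Fin n) (Fin n) ℝ} (hB : B.det ≠ 0) : SymmBody {x | B.mulVec x ∈ K} where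
  convex := by
    intro x hx y hy a b ha hb hab
    simp only [mem_ofPred_eq, Matrix.mulVec_add, Matrix.mulVec_smul]
    exact hK.convex hx hy ha hb hab
  isCompact := by
    have : {x | B.mulVec x ∈ K} = (fun x => B⁻¹.mulVec x) '' K := by
      ext x
      constructor
      · exact fun hx => ⟨_, hx, inv_mulVec_mulVec hB x⟩
      · rintro ⟨y, hy, rfl⟩
        simpa only [mem_ofPred_eq, mulVec_inv_mulVec hB] using hy
    rw [this]
    exact hK.isCompact.image (by fun_prop)
  neg_mem := by
    intro x hx
    simp only [mem_ofPred_eq, Matrix.mulVec_neg]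
    exact hK.neg_mem _ hx
  mem_nhds := by
    have hc : Continuous fun x => B.mulVec x := by fun_prop
    exact hc.continuousAt.preimage_mem_nhds (by rw [Matrix.mulVec_zero]; exact hK.mem_nhds)

/-- The volume product is invariant under linear changes of coordinates. -/
lemma SymmBody.volume_mul_preimage_le {n : ℕ} {K : Set (Fin n → ℝ)} (hK : SymmBody K)
    {B : Matrix (Fin n) (Fin n) ℝ} (hB : B.det ≠ 0) :
    (volume {x | B.mulVec x ∈ K}).toReal * (volume (polar {x | B.mulVec x ∈ K})).toReal ≤
      (volume K).toReal * (volume (polar K)).toReal := by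
  -- Polarity turns `B` into its inverse transpose, so the two determinant factors cancel.
  have hsub : polar {x | B.mulVec x ∈ K} ⊆ {y | (B⁻¹.transpose).mulVec y ∈ polar K} := by
    intro y hy x hx
    rw [Matrix.mulVec_transpose, ← Matrix.dotProduct_mulVec]
    exact hy _ (by rwa [mem_ofPred_eq, mulVec_inv_mulVec hB])
  have hdet : B⁻¹.transpose.det = B.det⁻¹ := by
    rw [Matrix.det_transpose, Matrix.det_nonsing_inv, Ring.inverse_eq_inv']
  have h1 := measure_mono (μ := volume) hsub
  rw [volume_preimage_mulVec (by rw [hdet]; exact inv_ne_zero hB), hdet, inv_inv] at h1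
  have hfin : volume (polar K) ≠ ⊤ := hK.isCompact_polar.measure_lt_top.ne
  have h2 := ENNReal.toReal_mono (by finiteness) h1
  rw [ENNReal.toReal_mul, ENNReal.toReal_ofReal (abs_nonneg _)] at h2
  rw [volume_preimage_mulVec hB, ENNReal.toReal_mul, ENNReal.toReal_ofReal (abs_nonneg _)]
  calc |B.det⁻¹| * (volume K).toReal * (volume (polar {x | B.mulVec x ∈ K})).toReal
      ≤ |B.det⁻¹| * (volume K).toReal * (|B.det| * (volume (polar K)).toReal) := by
        gcongr
    _ = (volume K).toReal * (volume (polar K)).toReal := by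
        rw [abs_inv]
        have := abs_pos.2 hB
        field_simp

lemma volume_preimage_inv_inter_orthant {n : ℕ} {A : Matrix (Fin n) (Fin n) ℝ} (hA : A.det ≠ 0)
    (S : Set (Fin n → ℝ)) (ε : Fin n → ℝ) :
    volume ({x | A⁻¹.mulVec x ∈ S} ∩ orthant ε) =
      ENNReal.ofReal |A⁻¹.det⁻¹| * volume (S ∩ {p | A.mulVec p ∈ orthant ε}) := by
  rw [← volume_preimage_mulVec (det_inv_ne_zero hA)]
  congr 1
  ext x
  simp only [mem_inter_iff, mem_ofPred_eq, mulVec_inv_mulVec hA]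

lemma measurePreserving_signs_mul {n : ℕ} {δ : Fin n → ℝ} (hδ : δ ∈ signs n) :
    MeasurePreserving (fun x : Fin n → ℝ => δ * x) volume volume := by
  refine volume_preserving_pi (f := fun i x => δ i * x) fun i => ?_
  rcases mem_signs.1 hδ i with h | h
  · simp only [h, one_mul]
    exact MeasurePreserving.id volume
  · simpa [h] using Measure.measurePreserving_neg volume

lemma signs_mul_self {n : ℕ} {δ : Fin n → ℝ} (hδ : δ ∈ signs n) : δ * δ = 1 := by
  funext i
  rcases mem_signs.1 hδ i with h | h <;> simp [h]

lemma signs_mul_mem {n : ℕ} {δ ε : Fin n → ℝ} (hδ : δ ∈ signs n) (hε : ε ∈ signs n) :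
    δ * ε ∈ signs n := by
  rw [mem_signs]
  intro i
  rcases mem_signs.1 hδ i with h | h <;> rcases mem_signs.1 hε i with h' | h' <;> simp [h, h']

lemma neg_one_mem_signs (n : ℕ) : (-1 : Fin n → ℝ) ∈ signs n := mem_signs.2 fun _ => Or.inr rfl

lemma volume_inter_orthant_mul {n : ℕ} {S : Set (Fin n → ℝ)} (hS : MeasurableSet S)
    {δ : Fin n → ℝ} (hδ : δ ∈ signs n) (hinv : ∀ x ∈ S, δ * x ∈ S) (ε : Fin n → ℝ) :
    volume (S ∩ orthant (δ * ε)) = volume (S ∩ orthant ε) := by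
  rw [← (measurePreserving_signs_mul hδ).measure_preimage
    (hS.inter (measurableSet_orthant ε)).nullMeasurableSet]
  congr 1
  ext x
  have h1 : δ * x ∈ S ↔ x ∈ S := by
    refine ⟨fun h => ?_, hinv x⟩
    have := hinv _ h
    rwa [← mul_assoc, signs_mul_self hδ, one_mul] at this
  have h2 : δ * x ∈ orthant ε ↔ x ∈ orthant (δ * ε) := by
    refine forall_congr' fun i => ?_
    rw [Pi.mul_apply, Pi.mul_apply, show ε i * (δ i * x i) = δ i * ε i * x i by ring]
  rw [mem_preimage, mem_inter_iff, mem_inter_iff, h1, h2]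

/-- A set invariant under all coordinate reflections is equipartitioned by the orthants. -/
lemma volume_le_of_forall_signs {n : ℕ} {S : Set (Fin n → ℝ)} (hS : MeasurableSet S)
    (hinv : ∀ δ ∈ signs n, ∀ x ∈ S, δ * x ∈ S) {ε : Fin n → ℝ} (hε : ε ∈ signs n) :
    volume S ≤ 2 ^ n * volume (S ∩ orthant ε) := by
  calc volume S ≤ ∑ η ∈ signs n, volume (S ∩ orthant η) := volume_le_sum_orthant S
    _ = ∑ _η ∈ signs n, volume (S ∩ orthant ε) := by
        refine Finset.sum_congr rfl fun η hη => ?_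
        rw [← volume_inter_orthant_mul hS (signs_mul_mem hη hε) (hinv _ (signs_mul_mem hη hε)) ε,
          mul_assoc, signs_mul_self hε, mul_one]
    _ = 2 ^ n * volume (S ∩ orthant ε) := by
        rw [Finset.sum_const, card_signs, nsmul_eq_mul]
        norm_cast

/-! ### Dimensions zero, one and two. -/

lemma eq_one_or_neg_one_of_mem_signs_one {δ : Fin 1 → ℝ} (hδ : δ ∈ signs 1) :
    δ = 1 ∨ δ = -1 := by
  rcases mem_signs.1 hδ 0 with h | h
  · exact Or.inl (funext fun i => by rw [Subsingleton.elim i 0]; exact h)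
  · exact Or.inr (funext fun i => by rw [Subsingleton.elim i 0]; exact h)

lemma SymmBody.one_le_volume_mul_dim_zero {S : Set (Fin 0 → ℝ)} (hS : SymmBody S) :
    1 ≤ (volume S).toReal * (volume (polar S)).toReal := by
  have h1 : S = univ := eq_univ_of_forall fun x => by
    rw [Subsingleton.elim x 0]
    exact mem_of_mem_nhds hS.mem_nhds
  have h2 : polar S = univ := eq_univ_of_forall fun y x _ => by simp
  rw [h2, h1]
  simp [volume_pi]

lemma SymmBody.neg_one_mul_mem {n : ℕ} {K : Set (Fin n → ℝ)} (hK : SymmBody K) (x : Fin n → ℝ)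
    (hx : x ∈ K) : -1 * x ∈ K := by
  rw [neg_one_mul]
  exact hK.neg_mem x hx

/-- On the line, central symmetry alone is equipartition, so the inductive step applies to the
one-point base case. -/
theorem SymmBody.four_le_volume_mul_dim_one {S : Set (Fin 1 → ℝ)} (hS : SymmBody S) :
    4 ≤ (volume S).toReal * (volume (polar S)).toReal := by
  have := hS.le_volume_mul_volume_polar (m := 1) (fun T hT => hT.one_le_volume_mul_dim_zero)
    (fun ε hε => ?_) (fun i ε hε => ?_)
  · simpa using this
  · have h0 : ∀ δ : Fin 1 → ℝ, volume (S ∩ orthant (-1 * δ)) = volume (S ∩ orthant δ) :=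
      volume_inter_orthant_mul hS.measurableSet (neg_one_mem_signs 1) hS.neg_one_mul_mem
    have hdisj : Disjoint (S ∩ orthant (-1 * ε)) (S ∩ orthant ε) := by
      rw [Set.disjoint_left]
      rintro x ⟨_, hx⟩ ⟨_, hx'⟩
      have h1 := hx 0
      have h2 := hx' 0
      simp only [Pi.mul_apply, Pi.neg_apply, Pi.one_apply] at h1
      linarith
    calc 2 ^ (0 + 1) * volume (S ∩ orthant ε)
        = volume (S ∩ orthant (-1 * ε)) + volume (S ∩ orthant ε) := by
          rw [h0]; ring
      _ = volume ((S ∩ orthant (-1 * ε)) ∪ (S ∩ orthant ε)) :=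
          (measure_union hdisj (hS.measurableSet.inter (measurableSet_orthant _))).symm
      _ ≤ volume S := measure_mono (union_subset inter_subset_left inter_subset_left)
  · refine volume_le_of_forall_signs (hS.slice i).measurableSet (fun δ _ x hx => ?_) hε
    rwa [Subsingleton.elim (δ * x) x]

lemma SymmBody.exists_norm_le_of_mem {n : ℕ} {K : Set (Fin n → ℝ)} (hK : SymmBody K) :
    ∃ R : ℝ, ∀ x ∈ K, ‖x‖ ≤ R := hK.isCompact.isBounded.exists_norm_le

lemma SymmBody.evenDensity_indicator {S : Set (Fin 2 → ℝ)} (hS : SymmBody S) :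
    EvenDensity (S.indicator 1) where
  measurable := measurable_one.indicator hS.measurableSet
  even := by
    intro p
    have h : -p ∈ S ↔ p ∈ S := ⟨fun h => by simpa using hS.neg_mem _ h, hS.neg_mem p⟩
    by_cases hp : p ∈ S
    · rw [indicator_of_mem hp, indicator_of_mem (h.2 hp)]; rfl
    · rw [indicator_of_notMem hp, indicator_of_notMem fun h' => hp (h.1 h')]
  bounded := ⟨1, by simp, fun p => indicator_le_self' (fun _ _ => zero_le) p⟩
  support := by
    obtain ⟨R, hR⟩ := hS.exists_norm_le_of_mem
    exact ⟨R, fun p hp => indicator_of_notMem (fun h => absurd (hR p h) (not_le.2 hp)) _⟩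

lemma volume_inter_eq_setLIntegral_indicator {n : ℕ} {S T : Set (Fin n → ℝ)}
    (hS : MeasurableSet S) : volume (S ∩ T) = ∫⁻ p in T, S.indicator 1 p := by
  rw [lintegral_indicator_one hS, Measure.restrict_apply hS]

lemma four_mul_volume_of_indicator {S : Set (Fin 2 → ℝ)} (hS : MeasurableSet S)
    {A : Matrix (Fin 2) (Fin 2) ℝ} (hA : A.det ≠ 0) {ε : Fin 2 → ℝ}
    (h : 4 * ∫⁻ p in {p | A.mulVec p ∈ orthant ε}, S.indicator 1 p = ∫⁻ p, S.indicator 1 p) :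
    4 * volume ({x | A⁻¹.mulVec x ∈ S} ∩ orthant ε) = volume {x | A⁻¹.mulVec x ∈ S} := by
  rw [← volume_inter_eq_setLIntegral_indicator hS, lintegral_indicator_one hS] at h
  rw [volume_preimage_inv_inter_orthant hA, volume_preimage_mulVec (det_inv_ne_zero hA), ← h]
  ring

/-- Mahler's inequality in the plane. -/
theorem SymmBody.eight_le_volume_mul_dim_two {K : Set (Fin 2 → ℝ)} (hK : SymmBody K) :
    8 ≤ (volume K).toReal * (volume (polar K)).toReal := by
  obtain ⟨r, hr, hrK⟩ := Metric.nhds_basis_ball.mem_iff.1 hK.mem_nhds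
  -- Only one body needs partitioning here, so its indicator serves as both densities. The
  -- coordinate sections are symmetric segments and are halved automatically.
  obtain ⟨A, hA, hε⟩ := exists_matrix_equipartition hK.evenDensity_indicator
    hK.evenDensity_indicator one_ne_zero hr (fun p hp => by
      rw [indicator_of_mem (hrK (mem_ball_zero_iff.2 hp))]; rfl)
  refine le_trans ?_ (hK.volume_mul_preimage_le (det_inv_ne_zero hA))
  have hK' := hK.preimage_mulVec (det_inv_ne_zero hA)
  have := hK'.le_volume_mul_volume_polar (m := 4) (fun T hT => hT.four_le_volume_mul_dim_one)
    (fun ε hεs => ?_) (fun i ε hεs => ?_)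
  · exact le_trans (by norm_num) this
  · rw [← four_mul_volume_of_indicator hK.measurableSet hA (hε ε hεs).1]
    norm_num
  · refine volume_le_of_forall_signs (hK'.slice i).measurableSet (fun δ hδ x hx => ?_) hεs
    rcases eq_one_or_neg_one_of_mem_signs_one hδ with rfl | rfl
    · rwa [one_mul]
    · exact (hK'.slice i).neg_one_mul_mem x hx

/-! ### Dimension three with a mirror plane. -/

lemma neg_ins {n : ℕ} (i : Fin (n + 1)) (s : ℝ) (p : Fin n → ℝ) :
    -ins i s p = ins i (-s) (-p) := ext_ins i (by simp) (by simp)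

lemma norm_ins_lt {n : ℕ} (i : Fin (n + 1)) {s r : ℝ} {p : Fin n → ℝ} (hr : 0 < r) (hs : |s| < r)
    (hp : ‖p‖ < r) : ‖ins i s p‖ < r := by
  rw [pi_norm_lt_iff hr]
  intro k
  rcases Fin.eq_self_or_eq_succAbove i k with rfl | ⟨j, rfl⟩
  · simpa using hs
  · rw [ins_succAbove]
    exact (norm_le_pi_norm p j).trans_lt hp

lemma norm_le_norm_ins {n : ℕ} (i : Fin (n + 1)) (s : ℝ) (p : Fin n → ℝ) :
    ‖p‖ ≤ ‖ins i s p‖ := by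
  rw [pi_norm_le_iff_of_nonneg (norm_nonneg _)]
  intro j
  simpa using norm_le_pi_norm (ins i s p) (i.succAbove j)

/-- By Fubini, the mass of this density on a planar set is the volume of `K` above it, so
partitioning it partitions `K` by planes parallel to axis `i`. -/
lemma SymmBody.evenDensity_fiber {K : Set (Fin 3 → ℝ)} (hK : SymmBody K) (i : Fin 3) :
    EvenDensity fun p => volume {s : ℝ | ins i s p ∈ K} where
  measurable := measurable_measure_prodMk_right
    ((continuous_ins i).measurable hK.measurableSet)
  even := by
    intro p
    have : {s : ℝ | ins i s (-p) ∈ K} = Neg.neg ⁻¹' {s : ℝ | ins i s p ∈ K} := by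
      ext s
      simp only [mem_ofPred_eq, mem_preimage]
      constructor
      · intro h
        simpa [neg_ins] using hK.neg_mem _ h
      · intro h
        simpa [neg_ins] using hK.neg_mem _ h
    rw [this, Measure.measure_preimage_neg]
  bounded := by
    obtain ⟨R, hR⟩ := hK.exists_norm_le_of_mem
    refine ⟨volume (Icc (-R) R), by simp, fun p => measure_mono fun s hs => ?_⟩
    have h1 := norm_le_pi_norm (ins i s p) i
    rw [ins_self] at h1
    exact abs_le.1 (h1.trans (hR _ hs))
  support := by
    obtain ⟨R, hR⟩ := hK.exists_norm_le_of_mem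
    refine ⟨R, fun p hp => ?_⟩
    have : {s : ℝ | ins i s p ∈ K} = ∅ := eq_empty_of_forall_notMem fun s hs =>
      absurd ((norm_le_norm_ins i s p).trans (hR _ hs)) (not_le.2 hp)
    rw [this, measure_empty]

/-- Extension of a planar matrix to space, fixing the last coordinate. -/
def extendMatrix (D : Matrix (Fin 2) (Fin 2) ℝ) : Matrix (Fin 3) (Fin 3) ℝ :=
  !![D 0 0, D 0 1, 0; D 1 0, D 1 1, 0; 0, 0, 1]

lemma det_extendMatrix (D : Matrix (Fin 2) (Fin 2) ℝ) : (extendMatrix D).det = D.det := by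
  rw [extendMatrix, Matrix.det_fin_three, Matrix.det_fin_two]
  simp

lemma extendMatrix_mulVec (D : Matrix (Fin 2) (Fin 2) ℝ) (s : ℝ) (p : Fin 2 → ℝ) :
    (extendMatrix D).mulVec (ins 2 s p) = ins 2 s (D.mulVec p) := by
  have h0 : ∀ (s : ℝ) (p : Fin 2 → ℝ), ins 2 s p 0 = p 0 := fun s p => ins_succAbove 2 s p 0
  have h1 : ∀ (s : ℝ) (p : Fin 2 → ℝ), ins 2 s p 1 = p 1 := fun s p => ins_succAbove 2 s p 1
  funext k
  fin_cases k
  · simp [extendMatrix, Matrix.mulVec, dotProduct, Fin.sum_univ_three, h0, h1]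
  · simp [extendMatrix, Matrix.mulVec, dotProduct, Fin.sum_univ_three, h0, h1]
  · simp [extendMatrix, Matrix.mulVec, dotProduct, Fin.sum_univ_three, h0, h1]

/-- The reflection in the last coordinate hyperplane of space, as a sign vector. -/
def lastFlip : Fin 3 → ℝ := ![1, 1, -1]

lemma lastFlip_mem_signs : lastFlip ∈ signs 3 := by
  rw [mem_signs]
  intro i
  fin_cases i <;> simp [lastFlip]

lemma lastFlip_mul_ins (s : ℝ) (p : Fin 2 → ℝ) : lastFlip * ins 2 s p = ins 2 (-s) p := by
  refine ext_ins 2 ?_ fun j => ?_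
  · simp [lastFlip]
  · rw [Pi.mul_apply, ins_succAbove, ins_succAbove]
    fin_cases j
    · change lastFlip 0 * p 0 = p 0
      simp [lastFlip]
    · change lastFlip 1 * p 1 = p 1
      simp [lastFlip]

lemma lastFlip_mul_preimage {K : Set (Fin 3 → ℝ)} (hflip : ∀ x ∈ K, lastFlip * x ∈ K)
    (D : Matrix (Fin 2) (Fin 2) ℝ) (x : Fin 3 → ℝ) (hx : (extendMatrix D).mulVec x ∈ K) :
    (extendMatrix D).mulVec (lastFlip * x) ∈ K := by
  rw [← ins_eta 2 x] at hx ⊢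
  rw [extendMatrix_mulVec] at hx
  rw [lastFlip_mul_ins, extendMatrix_mulVec, ← lastFlip_mul_ins]
  exact hflip _ hx

/-- Slices containing the reflected axis inherit all coordinate reflections. -/
lemma SymmBody.signs_mul_mem_slice {K : Set (Fin 3 → ℝ)} (hK : SymmBody K)
    (hflip : ∀ x ∈ K, lastFlip * x ∈ K) {i : Fin 3} (hi : i ≠ 2) (δ : Fin 2 → ℝ) (hδ : δ ∈ signs 2)
    (p : Fin 2 → ℝ) (hp : p ∈ VolumeProduct.slice i K) : δ * p ∈ VolumeProduct.slice i K := by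
  have hS := hK.slice i
  have h1 : ∀ q ∈ VolumeProduct.slice i K, (![1, -1] : Fin 2 → ℝ) * q ∈ VolumeProduct.slice i K := by
    intro q hq
    have := hflip _ hq
    change ins i 0 _ ∈ K
    convert this using 1
    refine ext_ins i (by simp) fun j => ?_
    rw [Pi.mul_apply, ins_succAbove, ins_succAbove, Pi.mul_apply]
    congr 1
    fin_cases i
    · fin_cases j <;> simp [lastFlip, Fin.succAbove]
    · fin_cases j <;> simp [lastFlip, Fin.succAbove]
    · exact absurd rfl hi
  have h2 : ∀ q ∈ VolumeProduct.slice i K, (![-1, 1] : Fin 2 → ℝ) * q ∈ VolumeProduct.slice i K := by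
    intro q hq
    have := hS.neg_mem _ (h1 q hq)
    convert this using 1
    funext j
    fin_cases j <;> simp
  have hδ' : δ = ![δ 0, δ 1] := by
    funext j
    fin_cases j <;> rfl
  rcases mem_signs.1 hδ 0 with e0 | e0 <;> rcases mem_signs.1 hδ 1 with e1 | e1 <;>
    rw [hδ', e0, e1]
  · convert hp using 1
    funext j
    fin_cases j <;> simp
  · exact h1 p hp
  · exact h2 p hp
  · convert hS.neg_mem p hp using 1
    funext j
    fin_cases j <;> simp

/-- Mahler's inequality for symmetric bodies in space which are symmetric in a coordinate plane. -/
theorem SymmBody.le_volume_mul_dim_three {K : Set (Fin 3 → ℝ)} (hK : SymmBody K)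
    (hflip : ∀ x ∈ K, lastFlip * x ∈ K) :
    32 / 3 ≤ (volume K).toReal * (volume (polar K)).toReal := by
  obtain ⟨r, hr, hrK⟩ := Metric.nhds_basis_ball.mem_iff.1 hK.mem_nhds
  -- Above any `p` with `‖p‖ < r`, the fibre of `K` contains `(-r, r)`; this is the lower bound for
  -- the density.
  have hr2 : ENNReal.ofReal (r - -r) ≠ 0 := by simp [hr]
  obtain ⟨A, hA, hε⟩ := exists_matrix_equipartition (hK.evenDensity_fiber 2)
    (hK.slice 2).evenDensity_indicator hr2 hr (fun p hp => by
      rw [← Real.volume_Ioo]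
      exact measure_mono fun s hs =>
        hrK (mem_ball_zero_iff.2 (norm_ins_lt 2 hr (abs_lt.2 hs) hp)))
  -- The linear change acts only within the mirror plane, so it commutes with the reflection.
  have hB : (extendMatrix A⁻¹).det ≠ 0 := by
    rw [det_extendMatrix]
    exact det_inv_ne_zero hA
  refine le_trans ?_ (hK.volume_mul_preimage_le hB)
  have hK' := hK.preimage_mulVec hB
  set K' := {x | (extendMatrix A⁻¹).mulVec x ∈ K} with hK'def
  have hflip' : ∀ x ∈ K', lastFlip * x ∈ K' := lastFlip_mul_preimage hflip A⁻¹
  have := hK'.le_volume_mul_volume_polar (m := 8) (fun T hT => hT.eight_le_volume_mul_dim_two)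
    (fun ε hεs => ?_) (fun i ε hεs => ?_)
  · exact le_trans (by norm_num) this
  -- The wedge over each quadrant of the mirror plane holds a quarter of the volume, and the
  -- reflection swaps its two octants.
  · set ε' : Fin 2 → ℝ := fun j => ε (Fin.succAbove 2 j) with hε'
    have hε's : ε' ∈ signs 2 := mem_signs.2 fun j => mem_signs.1 hεs _
    set H : Set (Fin 3 → ℝ) :=
      {x | (fun j => A.mulVec (fun j => x (Fin.succAbove 2 j)) j) ∈ orthant ε'} with hH
    have hHm : MeasurableSet H := by
      have hc : Continuous fun x : Fin 3 → ℝ =>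
        (fun j => A.mulVec (fun j => x (Fin.succAbove 2 j)) j) := by fun_prop
      exact hc.measurable (measurableSet_orthant ε')
    have hAm : MeasurableSet {p | A.mulVec p ∈ orthant ε'} := by
      have hc : Continuous fun p : Fin 2 → ℝ => A.mulVec p := by fun_prop
      exact hc.measurable (measurableSet_orthant ε')
    have h1 : 4 * volume (K ∩ H) = volume K := by
      rw [volume_eq_lintegral_fiber 2 hK.measurableSet, ← (hε ε' hε's).1,
        volume_eq_lintegral_fiber 2 (hK.measurableSet.inter hHm), ← lintegral_indicator hAm]
      congr 1
      refine lintegral_congr fun p => ?_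
      by_cases hp : p ∈ {p | A.mulVec p ∈ orthant ε'}
      · rw [indicator_of_mem hp]
        congr 1
        ext s
        simp only [hH, mem_ofPred_eq, mem_inter_iff, ins_succAbove]
        exact and_iff_left hp
      · rw [indicator_of_notMem hp]
        refine measure_mono_null (t := ∅) (fun s hs => hp ?_) measure_empty
        have := hs.2
        simpa only [hH, mem_ofPred_eq, ins_succAbove] using this
    have h2 : 4 * volume {x | (extendMatrix A⁻¹).mulVec x ∈ K ∩ H} = volume K' := by
      rw [volume_preimage_mulVec hB, hK'def, volume_preimage_mulVec hB, ← h1]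
      ring
    have hsub : ∀ η : Fin 3 → ℝ, (∀ j, η (Fin.succAbove 2 j) = ε' j) →
        K' ∩ orthant η ⊆ {x | (extendMatrix A⁻¹).mulVec x ∈ K ∩ H} := by
      rintro η hη x ⟨hxK, hx⟩
      refine ⟨hxK, ?_⟩
      rw [← ins_eta 2 x, extendMatrix_mulVec]
      simp only [hH, mem_ofPred_eq, ins_succAbove]
      change A.mulVec (A⁻¹.mulVec _) ∈ orthant ε'
      rw [mulVec_inv_mulVec hA]
      intro j
      rw [← hη]
      exact hx _
    have hdisj : Disjoint (K' ∩ orthant (lastFlip * ε)) (K' ∩ orthant ε) := by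
      rw [Set.disjoint_left]
      rintro x ⟨_, hx⟩ ⟨_, hx'⟩
      have h1 := hx 2
      have h2 := hx' 2
      simp only [Pi.mul_apply, lastFlip] at h1
      simp at h1
      linarith
    calc 2 ^ (2 + 1) * volume (K' ∩ orthant ε)
        = 4 * (volume (K' ∩ orthant (lastFlip * ε)) + volume (K' ∩ orthant ε)) := by
          rw [volume_inter_orthant_mul hK'.measurableSet lastFlip_mem_signs hflip']
          ring
      _ = 4 * volume ((K' ∩ orthant (lastFlip * ε)) ∪ (K' ∩ orthant ε)) := by
          rw [measure_union hdisj (hK'.measurableSet.inter (measurableSet_orthant _))]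
      _ ≤ 4 * volume {x | (extendMatrix A⁻¹).mulVec x ∈ K ∩ H} := by
          gcongr
          refine union_subset (hsub _ fun j => ?_) (hsub _ fun j => rfl)
          rw [Pi.mul_apply, hε']
          fin_cases j
          · change lastFlip 0 * ε 0 = ε 0
            simp [lastFlip]
          · change lastFlip 1 * ε 1 = ε 1
            simp [lastFlip]
      _ = volume K' := h2
  -- The section in the mirror plane was equipartitioned by the choice of `A`. The other two are
  -- invariant under a coordinate reflection and `-1`, hence under all sign changes.
  · by_cases hi : i = 2
    · subst hi
      have hsl : VolumeProduct.slice 2 K' = {p | A⁻¹.mulVec p ∈ VolumeProduct.slice 2 K} := by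
        ext p
        change (extendMatrix A⁻¹).mulVec (ins 2 0 p) ∈ K ↔ ins 2 0 (A⁻¹.mulVec p) ∈ K
        rw [extendMatrix_mulVec]
      rw [hsl, ← four_mul_volume_of_indicator (hK.slice 2).measurableSet hA (hε ε hεs).2]
      norm_num
    · exact volume_le_of_forall_signs (hK'.slice i).measurableSet
        (hK'.signs_mul_mem_slice hflip' hi) hεs

/-! ### Minimality of the polar volume at the centre of symmetry. -/

/-- The set of `w` with `w · (x - z) ≤ t` for all `x ∈ K`. -/
def polarAt {n : ℕ} (K : Set (Fin n → ℝ)) (z : Fin n → ℝ) (t : ℝ) : Set (Fin n → ℝ) :=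
  {w | ∀ x ∈ K, w ⬝ᵥ (x - z) ≤ t}

lemma polarAt_zero_one {n : ℕ} (K : Set (Fin n → ℝ)) : polarAt K 0 1 = polar K := by
  simp [polarAt, polar]

lemma volume_polarAt {n : ℕ} (K : Set (Fin n → ℝ)) (z : Fin n → ℝ) {t : ℝ} (ht : 0 < t) :
    volume (polarAt K z t) = ENNReal.ofReal (t ^ n) * volume (polarAt K z 1) := by
  rw [← volume_preimage_inv_smul_sub ht 0]
  congr 1
  ext w
  refine forall₂_congr fun x _ => ?_
  rw [sub_zero, smul_dotProduct, smul_eq_mul, inv_mul_le_iff₀ ht, mul_one]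

lemma polarAt_eq_empty {n : ℕ} {K : Set (Fin n → ℝ)} {z : Fin n → ℝ} (hz : z ∈ K) {t : ℝ}
    (ht : t < 0) : polarAt K z t = ∅ := by
  refine eq_empty_of_forall_notMem fun w hw => ?_
  have := hw z hz
  rw [sub_self, dotProduct_zero] at this
  linarith

lemma isClosed_polarAt_graph {n : ℕ} (K : Set (Fin n → ℝ)) (z : Fin n → ℝ) :
    IsClosed {q : ℝ × (Fin n → ℝ) | q.2 ∈ polarAt K z q.1} := by
  have : {q : ℝ × (Fin n → ℝ) | q.2 ∈ polarAt K z q.1} =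
      ⋂ x ∈ K, {q | q.2 ⬝ᵥ (x - z) ≤ q.1} := by
    ext q
    simp [polarAt]
  rw [this]
  exact isClosed_biInter fun x _ =>
    isClosed_le ((continuous_dotProduct_left _).comp continuous_snd) continuous_fst

/-- The weighted integral of the dilates of the polar at a point. -/
noncomputable def expPolar {n : ℕ} (K : Set (Fin n → ℝ)) (z : Fin n → ℝ) : ℝ≥0∞ :=
  ∫⁻ t : ℝ, ENNReal.ofReal (Real.exp (-t)) * volume (polarAt K z t)

/-- The set `polarAt K z t` is a dilate by `t` for `t > 0` and empty for `t < 0`, so `expPolar` is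
the volume of the polar times a Gamma integral independent of `z`. -/
lemma expPolar_eq {n : ℕ} {K : Set (Fin n → ℝ)} {z : Fin n → ℝ} (hz : z ∈ K) :
    expPolar K z = (∫⁻ t in Ioi (0 : ℝ), ENNReal.ofReal (Real.exp (-t) * t ^ n)) *
      volume (polarAt K z 1) := by
  rw [← lintegral_mul_const _ (by fun_prop), ← lintegral_indicator measurableSet_Ioi, expPolar]
  refine lintegral_congr_ae ?_
  filter_upwards [Measure.ae_ne volume (0 : ℝ)] with t ht
  rcases lt_or_gt_of_ne ht with h | h
  · rw [polarAt_eq_empty hz h, indicator_of_notMem (by simpa using h.le), measure_empty, mul_zero]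
  · rw [indicator_of_mem (mem_Ioi.2 h), volume_polarAt K z h, ← mul_assoc,
      ← ENNReal.ofReal_mul (Real.exp_nonneg _)]

/-- The exponential of minus the support function of `K`. -/
noncomputable def expSupport {n : ℕ} (K : Set (Fin n → ℝ)) (w : Fin n → ℝ) : ℝ≥0∞ :=
  ∫⁻ s in {s | ∀ x ∈ K, w ⬝ᵥ x ≤ s}, ENNReal.ofReal (Real.exp (-s))

lemma measurableSet_support_le {n : ℕ} (K : Set (Fin n → ℝ)) (w : Fin n → ℝ) :
    MeasurableSet {s | ∀ x ∈ K, w ⬝ᵥ x ≤ s} := by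
  have : {s | ∀ x ∈ K, w ⬝ᵥ x ≤ s} = ⋂ x ∈ K, Ici (w ⬝ᵥ x) := by
    ext s
    simp
  rw [this]
  exact (isClosed_biInter fun x _ => isClosed_Ici).measurableSet

/-- Exchange the integrals and substitute `s = t + w ⬝ᵥ z`: membership in `polarAt K z t` becomes
the condition that the support function at `w` is at most `s`. The dependence on `z` is then a
single exponential factor. -/
lemma expPolar_eq_lintegral {n : ℕ} (K : Set (Fin n → ℝ)) (z : Fin n → ℝ) :
    expPolar K z = ∫⁻ w, ENNReal.ofReal (Real.exp (w ⬝ᵥ z)) * expSupport K w := by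
  have hG := (isClosed_polarAt_graph K z).measurableSet
  set G := {q : ℝ × (Fin n → ℝ) | q.2 ∈ polarAt K z q.1} with hGdef
  have h1 : expPolar K z = ∫⁻ t : ℝ, ∫⁻ w : Fin n → ℝ,
      G.indicator (fun q => ENNReal.ofReal (Real.exp (-q.1))) (t, w) := by
    refine lintegral_congr fun t => ?_
    have hm : MeasurableSet (polarAt K z t) :=
      measurable_prodMk_left (x := t) hG
    rw [← lintegral_indicator_const hm]
    rfl
  rw [h1, lintegral_lintegral_swap (Measurable.aemeasurable (by
    exact (Measurable.indicator (by fun_prop) hG)))]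
  refine lintegral_congr fun w => ?_
  rw [← lintegral_sub_right_eq_self _ (w ⬝ᵥ z), expSupport,
    ← lintegral_indicator (measurableSet_support_le K w),
    ← lintegral_const_mul _ (Measurable.indicator (by fun_prop) (measurableSet_support_le K w))]
  refine lintegral_congr fun s => ?_
  have h2 : (s - w ⬝ᵥ z, w) ∈ G ↔ s ∈ {s | ∀ x ∈ K, w ⬝ᵥ x ≤ s} := by
    refine forall₂_congr fun x _ => ?_
    rw [dotProduct_sub, sub_le_sub_iff_right]
  by_cases hs : s ∈ {s | ∀ x ∈ K, w ⬝ᵥ x ≤ s}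
  · rw [indicator_of_mem hs, indicator_of_mem (h2.2 hs), ← ENNReal.ofReal_mul (Real.exp_nonneg _),
      ← Real.exp_add]
    congr 2
    ring
  · rw [indicator_of_notMem hs, indicator_of_notMem fun h => hs (h2.1 h), mul_zero]

lemma SymmBody.expSupport_neg {n : ℕ} {K : Set (Fin n → ℝ)} (hK : SymmBody K) (w : Fin n → ℝ) :
    expSupport K (-w) = expSupport K w := by
  have : {s | ∀ x ∈ K, -w ⬝ᵥ x ≤ s} = {s | ∀ x ∈ K, w ⬝ᵥ x ≤ s} := by
    ext s
    constructor
    · intro h x hx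
      have := h _ (hK.neg_mem x hx)
      rwa [neg_dotProduct_neg] at this
    · intro h x hx
      have := h _ (hK.neg_mem x hx)
      rwa [dotProduct_neg, ← neg_dotProduct] at this
  rw [expSupport, this, expSupport]

/-- The support function is even, so averaging over `w` and `-w` replaces the exponential factor by
a hyperbolic cosine, which is at least 1 and equals 1 at `z = 0`. -/
lemma SymmBody.expPolar_zero_le {n : ℕ} {K : Set (Fin n → ℝ)} (hK : SymmBody K)
    (z : Fin n → ℝ) : expPolar K 0 ≤ expPolar K z := by
  have h1 : expPolar K z = ∫⁻ w, ENNReal.ofReal (Real.exp (-(w ⬝ᵥ z))) * expSupport K w := by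
    rw [expPolar_eq_lintegral, ← lintegral_neg_eq_self]
    refine lintegral_congr fun w => ?_
    rw [hK.expSupport_neg, neg_dotProduct]
  have hm : Measurable (expSupport K) := by
    have hG : MeasurableSet {q : (Fin n → ℝ) × ℝ | ∀ x ∈ K, q.1 ⬝ᵥ x ≤ q.2} := by
      have : {q : (Fin n → ℝ) × ℝ | ∀ x ∈ K, q.1 ⬝ᵥ x ≤ q.2} =
          ⋂ x ∈ K, {q | q.1 ⬝ᵥ x ≤ q.2} := by
        ext q
        simp
      rw [this]
      exact (isClosed_biInter fun x _ =>
        isClosed_le ((continuous_dotProduct_left _).comp continuous_fst)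
          continuous_snd).measurableSet
    have h := Measurable.lintegral_prod_right' (ν := (volume : Measure ℝ))
      (f := {q : (Fin n → ℝ) × ℝ | ∀ x ∈ K, q.1 ⬝ᵥ x ≤ q.2}.indicator
        fun q => ENNReal.ofReal (Real.exp (-q.2))) (Measurable.indicator (by fun_prop) hG)
    convert h using 1
    funext w
    rw [expSupport, ← lintegral_indicator (measurableSet_support_le K w)]
    rfl
  have hdm : Measurable fun w : Fin n → ℝ => w ⬝ᵥ z := (continuous_dotProduct_left z).measurable
  have h2 : 2 * expPolar K 0 ≤ 2 * expPolar K z := by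
    calc 2 * expPolar K 0 = ∫⁻ w, 2 * expSupport K w := by
          rw [expPolar_eq_lintegral, lintegral_const_mul _ hm]
          simp
      _ ≤ ∫⁻ w, (ENNReal.ofReal (Real.exp (w ⬝ᵥ z)) * expSupport K w +
            ENNReal.ofReal (Real.exp (-(w ⬝ᵥ z))) * expSupport K w) := by
          refine lintegral_mono fun w => ?_
          rw [← add_mul, ← ENNReal.ofReal_add (Real.exp_nonneg _) (Real.exp_nonneg _)]
          gcongr
          rw [show (2 : ℝ≥0∞) = ENNReal.ofReal 2 by simp]
          refine ENNReal.ofReal_le_ofReal ?_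
          have h3 := Real.add_one_le_exp (w ⬝ᵥ z)
          have h4 := Real.add_one_le_exp (-(w ⬝ᵥ z))
          linarith
      _ = expPolar K z + expPolar K z := by
          rw [lintegral_add_left (by fun_prop), ← h1, ← expPolar_eq_lintegral]
      _ = 2 * expPolar K z := (two_mul _).symm
  exact (ENNReal.mul_le_mul_iff_right two_ne_zero (by simp)).1 h2

/-- Among all points of a symmetric body the origin minimises the volume of the polar. -/
theorem SymmBody.volume_polar_le {n : ℕ} {K : Set (Fin n → ℝ)} (hK : SymmBody K)
    {z : Fin n → ℝ} (hz : z ∈ K) : volume (polar K) ≤ volume (polarAt K z 1) := by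
  have h := hK.expPolar_zero_le z
  rw [expPolar_eq (mem_of_mem_nhds hK.mem_nhds), expPolar_eq hz, polarAt_zero_one] at h
  have hint := Real.GammaIntegral_convergent (s := n + 1) (by positivity)
  simp only [add_sub_cancel_right, Real.rpow_natCast] at hint
  have hgam := Real.Gamma_nat_eq_factorial n
  rw [Real.Gamma_eq_integral (by positivity)] at hgam
  simp only [add_sub_cancel_right, Real.rpow_natCast] at hgam
  have hc : ∫⁻ t in Ioi (0 : ℝ), ENNReal.ofReal (Real.exp (-t) * t ^ n) =
      ENNReal.ofReal n.factorial := by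
    rw [← hgam, ofReal_integral_eq_lintegral_ofReal hint]
    filter_upwards [self_mem_ae_restrict measurableSet_Ioi] with t ht
    exact mul_nonneg (Real.exp_nonneg _) (pow_nonneg (mem_Ioi.1 ht).le _)
  rw [hc] at h
  refine (ENNReal.mul_le_mul_iff_right ?_ ENNReal.ofReal_ne_top).1 h
  simpa using n.factorial_ne_zero

/-! ### From Euclidean space with an arbitrary mirror to coordinates. -/

/-- The mirror of a bounded origin-symmetric set passes through the origin, so that the linear
reflection preserves the set as well. -/
lemma linear_reflection_mem {E : Type*} [NormedAddCommGroup E] [InnerProductSpace ℝ E]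
    {K : Set E} (hbdd : Bornology.IsBounded K) (hneg : ∀ x ∈ K, -x ∈ K) (P : AffineSubspace ℝ E)
    [Nonempty P] [P.direction.HasOrthogonalProjection]
    (hsymm : ∀ x ∈ K, EuclideanGeometry.reflection P x ∈ K) :
    ∀ x ∈ K, P.direction.reflection x ∈ K := by
  obtain ⟨p⟩ := ‹Nonempty P›
  set c : E := (p : E) - P.direction.reflection p with hc
  have hσ : ∀ x, EuclideanGeometry.reflection P x = P.direction.reflection x + c := by
    intro x
    rw [EuclideanGeometry.reflection_apply_of_mem P x p.2, vsub_eq_sub, vadd_eq_add, map_sub, hc]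
    abel
  have hRc : P.direction.reflection c = -c := by
    rw [hc, map_sub, Submodule.reflection_reflection]
    abel
  -- Writing the reflection as `σ`, the map `x ↦ σ (-σ (-x))` preserves `K` and is translation by `2
  -- c`; a bounded set then forces `c = 0`.
  have htrans : ∀ x ∈ K, x + (2 : ℝ) • c ∈ K := by
    intro x hx
    have h1 := hneg _ (hsymm _ (hneg x hx))
    have h2 := hsymm _ h1
    rw [hσ, hσ] at h2
    convert h2 using 1
    simp only [map_neg, map_add, Submodule.reflection_reflection, hRc, two_smul]
    abel
  intro x hx
  have hiter : ∀ k : ℕ, x + (k : ℝ) • (2 : ℝ) • c ∈ K := by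
    intro k
    induction k with
    | zero => simpa using hx
    | succ k ih =>
      convert htrans _ ih using 1
      push_cast
      module
  obtain ⟨R, hR⟩ := hbdd.exists_norm_le
  have hc0 : c = 0 := by
    by_contra hne
    have hpos : 0 < ‖(2 : ℝ) • c‖ := norm_pos_iff.2 (smul_ne_zero two_ne_zero hne)
    obtain ⟨k, hk⟩ := exists_nat_gt ((R + ‖x‖) / ‖(2 : ℝ) • c‖)
    rw [div_lt_iff₀ hpos] at hk
    have h1 := hR _ (hiter k)
    have h2 := norm_sub_le (x + (k : ℝ) • (2 : ℝ) • c) x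
    rw [add_sub_cancel_left, norm_smul, Real.norm_natCast] at h2
    linarith
  have := hsymm x hx
  rwa [hσ, hc0, add_zero] at this

/-- An orthonormal basis in which the reflection in a plane changes the last sign. -/
lemma exists_orthonormalBasis_reflection (D : Submodule ℝ (EuclideanSpace ℝ (Fin 3)))
    (hD : Module.finrank ℝ D = 2) :
    ∃ b : OrthonormalBasis (Fin 3) ℝ (EuclideanSpace ℝ (Fin 3)),
      ∀ x k, b.repr (D.reflection x) k = lastFlip k * b.repr x k := by
  have h1 : Module.finrank ℝ Dᗮ = 1 := by
    have := D.finrank_add_finrank_orthogonal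
    rw [hD, finrank_euclideanSpace_fin] at this
    omega
  obtain ⟨v, hv, hspan⟩ := finrank_eq_one_iff'.1 h1
  have hv0 : (v : EuclideanSpace ℝ (Fin 3)) ≠ 0 := fun h => hv (Subtype.ext h)
  set u : EuclideanSpace ℝ (Fin 3) := (‖(v : EuclideanSpace ℝ (Fin 3))‖)⁻¹ • v with hu
  have hu1 : ‖u‖ = 1 := by
    rw [hu, norm_smul, norm_inv, norm_norm, inv_mul_cancel₀ (norm_ne_zero_iff.2 hv0)]
  have huD : u ∈ Dᗮ := Submodule.smul_mem _ _ v.2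
  -- Only index `2` of the constant family is prescribed: `b 2` is the unit normal `u`.
  obtain ⟨b, hb⟩ := Orthonormal.exists_orthonormalBasis_extension_of_card_eq (𝕜 := ℝ)
    (E := EuclideanSpace ℝ (Fin 3)) (ι := Fin 3) (by simp) (v := fun _ => u) (s := {2}) (by
      constructor
      · intro i
        exact hu1
      · intro i j hij
        exact absurd (Subsingleton.elim i j) hij)
  have hb2 : b 2 = u := hb 2 rfl
  have hmem : ∀ k, k ≠ 2 → b k ∈ D := by
    intro k hk
    rw [← D.orthogonal_orthogonal, Submodule.mem_orthogonal]
    intro w hw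
    obtain ⟨c, hc⟩ := hspan ⟨w, hw⟩
    have hc' : c • (v : EuclideanSpace ℝ (Fin 3)) = w := congrArg Subtype.val hc
    have hvu : (v : EuclideanSpace ℝ (Fin 3)) = ‖(v : EuclideanSpace ℝ (Fin 3))‖ • b 2 := by
      rw [hb2, hu, smul_smul, mul_inv_cancel₀ (norm_ne_zero_iff.2 hv0), one_smul]
    rw [← hc', hvu, smul_smul, real_inner_smul_left, b.orthonormal.2 (Ne.symm hk), mul_zero]
  refine ⟨b, fun x k => ?_⟩
  -- A linear reflection is an isometric involution, hence self-adjoint.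
  have hadj : inner ℝ (b k) (D.reflection x) = inner ℝ (D.reflection (b k)) x := by
    rw [← D.reflection.inner_map_map, Submodule.reflection_reflection]
  rw [b.repr_apply_apply, b.repr_apply_apply, hadj]
  by_cases hk : k = 2
  · subst hk
    rw [Submodule.reflection_mem_subspace_orthogonalComplement_eq_neg (by rwa [hb2]),
      inner_neg_left]
    simp [lastFlip]
  · rw [Submodule.reflection_mem_subspace_eq_self (hmem k hk)]
    have : lastFlip k = 1 := by
      fin_cases k
      · simp [lastFlip]
      · simp [lastFlip]
      · exact absurd rfl hk
    rw [this, one_mul]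

/-- Coordinates with respect to an orthonormal basis. -/
noncomputable def coords {n : ℕ} (b : OrthonormalBasis (Fin n) ℝ (EuclideanSpace ℝ (Fin n))) :
    EuclideanSpace ℝ (Fin n) ≃L[ℝ] (Fin n → ℝ) :=
  b.repr.toContinuousLinearEquiv.trans (PiLp.continuousLinearEquiv 2 ℝ fun _ => ℝ)

section

variable {n : ℕ} (b : OrthonormalBasis (Fin n) ℝ (EuclideanSpace ℝ (Fin n)))

lemma coords_apply (x : EuclideanSpace ℝ (Fin n)) (k : Fin n) : coords b x k = b.repr x k := rfl

lemma coords_dotProduct (x y : EuclideanSpace ℝ (Fin n)) :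
    coords b x ⬝ᵥ coords b y = inner ℝ x y := by
  rw [← b.repr.inner_map_map, PiLp.inner_apply, dotProduct]
  refine Finset.sum_congr rfl fun k _ => ?_
  rw [coords_apply, coords_apply]
  simp [mul_comm]

lemma volume_image_coords (S : Set (EuclideanSpace ℝ (Fin n))) :
    volume (coords b '' S) = volume S := by
  have hmp : MeasurePreserving (coords b).toHomeomorph.toMeasurableEquiv volume volume :=
    (PiLp.volume_preserving_ofLp (Fin n)).comp b.measurePreserving_repr
  rw [← hmp.measure_preimage_equiv]
  congr 1
  exact preimage_image_eq S (coords b).injective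

lemma symmBody_image_coords {K : Set (EuclideanSpace ℝ (Fin n))} (hK : IsConvexBody K)
    (hneg : ∀ x ∈ K, -x ∈ K) : SymmBody (coords b '' K) where
  convex := hK.convex.linear_image (coords b).toLinearEquiv.toLinearMap
  isCompact := hK.isCompact.image (coords b).continuous
  neg_mem := by
    rintro _ ⟨x, hx, rfl⟩
    exact ⟨-x, hneg x hx, map_neg _ _⟩
  mem_nhds := by
    -- The origin is the midpoint of the interior points `z` and `-z`.
    obtain ⟨z, hz⟩ := hK.interior_nonempty
    have hnegint : -z ∈ interior K := by
      have : K = Neg.neg ⁻¹' K := by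
        ext x
        exact ⟨hneg x, fun h => by simpa using hneg _ h⟩
      rw [this]
      exact preimage_interior_subset_interior_preimage continuous_neg (by simpa using hz)
    have h0 : (0 : EuclideanSpace ℝ (Fin n)) ∈ interior K := by
      have := hK.convex.interior hz hnegint (a := 1 / 2) (b := 1 / 2) (by norm_num) (by norm_num)
        (by norm_num)
      simpa using this
    have := (coords b).toHomeomorph.isOpenMap.image_mem_nhds (mem_interior_iff_mem_nhds.1 h0)
    simpa using this

/-- The coordinates preserve inner products and volume. The remaining difference is a translation by
`z`, because `polarAt` uses `w = y - z`. -/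
lemma volume_polarAt_image_coords (K : Set (EuclideanSpace ℝ (Fin n)))
    (z : EuclideanSpace ℝ (Fin n)) :
    volume (polarAt (coords b '' K) (coords b z) 1) = volume (polarBody K z) := by
  have h : polarAt (coords b '' K) (coords b z) 1 =
      coords b '' ((fun y => y + z) ⁻¹' polarBody K z) := by
    ext w
    obtain ⟨y, rfl⟩ := (coords b).surjective w
    rw [(coords b).injective.mem_set_image]
    simp only [polarAt, polarBody, mem_ofPred_eq, mem_preimage, forall_mem_image, ← map_sub,
      coords_dotProduct, add_sub_cancel_right]
  rw [h, volume_image_coords, measure_preimage_add_right]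

end

/-- Mahler's inequality for symmetric convex bodies in space which are symmetric in a plane. -/
theorem le_volumeProduct_of_reflection (K : Set (EuclideanSpace ℝ (Fin 3)))
    (hK : IsConvexBody K) (hcentral : IsCentrallySymmetric K)
    (P : AffineSubspace ℝ (EuclideanSpace ℝ (Fin 3))) [Nonempty P]
    (hP : Module.finrank ℝ P.direction = 2)
    (hsymm : EuclideanGeometry.reflection P '' K = K) :
    (32 / 3 : ℝ≥0∞) ≤ volumeProduct K := by
  have hneg : ∀ x ∈ K, -x ∈ K := by
    intro x hx
    have h : K = -K := hcentral
    rw [h]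
    simpa using hx
  have hrefl := linear_reflection_mem hK.isCompact.isBounded hneg P fun x hx => by
    rw [← hsymm]
    exact mem_image_of_mem _ hx
  obtain ⟨b, hb⟩ := exists_orthonormalBasis_reflection P.direction hP
  have hbody := symmBody_image_coords b hK hneg
  have hflip : ∀ x ∈ coords b '' K, lastFlip * x ∈ coords b '' K := by
    rintro _ ⟨x, hx, rfl⟩
    exact ⟨_, hrefl x hx, funext fun k => hb x k⟩
  have hmain := hbody.le_volume_mul_dim_three hflip
  rw [← ENNReal.toReal_mul] at hmain
  have hmain' := ENNReal.ofReal_le_of_le_toReal hmain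
  rw [ENNReal.ofReal_div_of_pos (by norm_num), ENNReal.ofReal_ofNat, ENNReal.ofReal_ofNat] at hmain'
  refine le_iInf₂ fun z hz => hmain'.trans ?_
  rw [volume_image_coords, ← volume_polarAt_image_coords b]
  exact mul_le_mul_right (hbody.volume_polar_le (mem_image_of_mem _ (interior_subset hz))) _

end VolumeProduct

theorem mainTheorem5 (K : Set (EuclideanSpace ℝ (Fin 3)))
    (hK : IsConvexBody K) (hcentral : IsCentrallySymmetric K)
    (hsmooth : IsSmoothHypersurface (frontier K)) (hstrong : IsStronglyConvexBody K)
    (P : AffineSubspace ℝ (EuclideanSpace ℝ (Fin 3))) [Nonempty P]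
    (hP : Module.finrank ℝ P.direction = 2)
    (hsymm : EuclideanGeometry.reflection P '' K = K) :
    (32 / 3 : ℝ≥0∞) ≤ volumeProduct K :=
  VolumeProduct.le_volumeProduct_of_reflection K hK hcentral P hP hsymm
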